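/- **Setting.** Let $\phi:\mathcal S\times\mathcal A\to\mathbb R^d$ be a known feature mapping and $n\in\mathbb N$. A linear contextual bandit instance $\mathcal Q=(\rho,\{(s_i,a_i)\}_{i=1}^n,\theta^\star,R)$ consists of a test distribution $\rho$ on $\mathcal S$ (known to the learner), fixed covariates $(s_i,a_i)$, a parameter $\theta^\star\in\mathbb R^d$, and reward distributions $R(s,a)$ with mean $\phi(s,a)^\top\theta^\star$ that are $1$-subgaussian, i.e. $\mathbb P_{X\sim R(s,a)}(|X-\mathbb EX|\ge t)\le 2e^{-t^2/2}$ for all $t\ge0$. The learner observes $\mathcal D=\{(s_i,a_i,r_i)\}_{i=1}^n$ with independent $r_i\sim R(s_i,a_i)$, and a learning rule $\hat\pi$ maps $\mathcal D$ (and $\rho$) to a deterministic policy $\mathcal S\to\mathcal A$, measurably in the rewards. The value of a policy is $V_{\mathcal Q}(\pi)=\mathbb E_{s\sim\rho}[\phi(s,\pi(s))^\top\theta^\star]$; policies are required to have $\phi(s,\pi(s))$ $\rho$-integrable. An optimal policy $\pi^\star$ satisfies $\pi^\star(s)\in\arg\max_a\phi(s,a)^\top\theta^\star$ for all $s$, and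 $V^\star_{\mathcal Q}$ is the optimal value. Let $\Phi\in\mathbb R^{n\times d}$ have rows $\phi(s_i,a_i)^\top$ and $\Sigma=\frac1n\Phi^\top\Phi$. For $q\in[1,\infty]$ and $\Lambda>0$, $\mathsf{CB}_q(\Lambda)$ is the set of instances (for the given $\phi,n$) with $\Sigma$ invertible that have an optimal policy and satisfy $$\bigl\|\Sigma^{-1/2}\,\mathbb E_{s\sim\rho}[\phi(s,\pi^\star(s))]\bigr\|_q\le\Lambda$$ for every optimal policy $\pi^\star$. Let $\mathsf{CB}^{\dagger}_q(\Lambda)$ be the class obtained by allowing $\Sigma$ to be singular, requiring $\mathbb E_{s\sim\rho}[\phi(s,\pi^\star(s))]\in\operatorname{range}\Sigma$, and reading $\Sigma^{-1/2}$ as the Moore–Penrose inverse of $\Sigma^{1/2}$. Conventions: $1/\infty=0$; $p,q\in[1,\infty]$ are dual if $1/p+1/q=1$. **Lower bound.** There is a universal constant $c>0$ such that for every $d\ge2$ there is a feature mapping $\phi$ into $\mathbb R^d$ on finite nonempty state and action spaces such that the following hold. 1. For all dual $p,q$, all $\Lambda\ge\sqrt8\,d^{1/q-1/2}$ and all $n\ge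 d^{2/p}\Lambda^2$, $$\inf_{\hat\pi}\ \sup_{\mathcal Q\in\mathsf{CB}_q(\Lambda)}\mathbb E\bigl[V^\star_{\mathcal Q}-V_{\mathcal Q}(\hat\pi)\bigr]\ \ge\ c\,d^{1/p}\,\Lambda/\sqrt n .$$ 2. For $p=\infty$, $q=1$ the range extends: for all $\Lambda\ge2$ and $n\ge\Lambda^2$, the bound $\ge c\,\Lambda/\sqrt n$ holds over $\mathsf{CB}^{\dagger}_1(\Lambda)$, and if moreover $n\ge d$ it holds over $\mathsf{CB}_1(\Lambda)$. **Matching upper bounds.** For $p\in[1,\infty]$ and $\beta>0$ let $\hat\theta=(\Phi^\top\Phi)^{-1}\Phi^\top r$, $\Theta_p=\{\theta:\|\Sigma^{1/2}(\theta-\hat\theta)\|_p\le\beta/2\}$, and let $\hat\pi_p$ be any maximizer over policies $\pi$ of $\inf_{\theta\in\Theta_p}\mathbb E_{s\sim\rho}[\phi(s,\pi(s))^\top\theta]$. There is a universal constant $C>0$ such that for every $d\ge2$, every feature mapping $\phi$ into $\mathbb R^d$, every $n$, all dual $p,q$, every $\Lambda$ and $\delta\in(0,1)$, and every instance with invertible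 $\Sigma$ such that $\|\Sigma^{-1/2}\mathbb E_{s\sim\rho}[\phi(s,\pi^\star(s))]\|_q\le\Lambda$ for some optimal policy $\pi^\star$ (in particular for every instance in $\mathsf{CB}_q(\Lambda)$): 3. with width $\beta=C\,d^{1/p}\sqrt{\log(d/\delta)/n}$, with probability at least $1-\delta$, $$V^\star_{\mathcal Q}-V_{\mathcal Q}(\hat\pi_p)\le C\,d^{1/p}\sqrt{\log(d/\delta)/n}\;\Lambda,$$ so $\hat\pi_p$ is minimax optimal over $\mathsf{CB}_q(\Lambda)$ up to logarithmic factors; 4. with width $\beta=C\sqrt{\log(d/\delta)/n}$, which does not depend on $q$ and $\Lambda$, with probability at least $1-\delta$, $$V^\star_{\mathcal Q}-V_{\mathcal Q}(\hat\pi_\infty)\le C\,d^{1/p}\sqrt{\log(d/\delta)/n}\;\Lambda,$$ so $\hat\pi_\infty$ is adaptively minimax optimal, up to logarithmic factors, over all the classes $\mathsf{CB}_q(\Lambda)$ at once. -/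

import Mathlib

open MeasureTheory
open scoped Matrix ENNReal

noncomputable section

namespace OfflineCB

/-- The `ℓ_p` norm of a real vector, `1 ≤ p ≤ ∞`. -/
def lpNormVec {d : ℕ} (p : ℝ≥0∞) (v : Fin d → ℝ) : ℝ := ‖WithLp.toLp p v‖

/-- The principal square root of a positive semidefinite matrix. -/
def matSqrt {d : ℕ} (M : Matrix (Fin d) (Fin d) ℝ) : Matrix (Fin d) (Fin d) ℝ :=
  cfc Real.sqrt M

/-- `M ^ (-1/2)` for a positive definite matrix `M`. The functional calculus acts on eigenvalues;
since `0⁻¹ = 0`, for a singular positive semidefinite `M` this is the Moore-Penrose inverse of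
the principal square root. -/
def matInvSqrt {d : ℕ} (M : Matrix (Fin d) (Fin d) ℝ) : Matrix (Fin d) (Fin d) ℝ :=
  cfc (fun x : ℝ => (Real.sqrt x)⁻¹) M

/-- A law on `ℝ` is `1`-subgaussian: `P(|X - E X| ≥ t) ≤ 2 exp(-t²/2)` for all `t ≥ 0`. -/
def IsOneSubgaussian (μ : Measure ℝ) : Prop :=
  ∀ t : ℝ, 0 ≤ t →
    μ {x : ℝ | t ≤ |x - ∫ y, y ∂μ|} ≤ ENNReal.ofReal (2 * Real.exp (-t ^ 2 / 2))

variable {S A : Type*} [MeasurableSpace S] {d : ℕ}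

/-- An instance of the offline linear contextual bandit problem with known feature mapping `φ`
and sample size `n`: the test distribution, the fixed covariates, the parameter, and the reward
distributions, which are `1`-subgaussian with linear means. -/
structure Instance (φ : S → A → Fin d → ℝ) (n : ℕ) where
  rho : ProbabilityMeasure S
  cov : Fin n → S × A
  theta : Fin d → ℝ
  R : S → A → ProbabilityMeasure ℝ
  integrable_R : ∀ s a, Integrable (fun x : ℝ => x) (R s a : Measure ℝ)
  mean_R : ∀ s a, ∫ x, x ∂(R s a : Measure ℝ) = φ s a ⬝ᵥ theta
  subgaussian_R : ∀ s a, IsOneSubgaussian (R s a : Measure ℝ)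

/-- The deterministic policies whose expected feature vector under `ρ` exists (for finite state
spaces: all of them). -/
def Admissible (φ : S → A → Fin d → ℝ) (ρ : ProbabilityMeasure S) (π : S → A) : Prop :=
  Integrable (fun s => φ s (π s)) (ρ : Measure S)

namespace Instance

variable {φ : S → A → Fin d → ℝ} {n : ℕ} (Q : Instance φ n)

/-- The law of the observed rewards: independent, `r i ∼ R (s i) (a i)`. -/
def rewardLaw : Measure (Fin n → ℝ) :=
  Measure.pi fun i => (Q.R (Q.cov i).1 (Q.cov i).2 : Measure ℝ)

/-- `V(π) = E_{s ∼ ρ} [φ(s, π(s))ᵀ θ]`. -/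
def value (π : S → A) : ℝ := ∫ s, φ s (π s) ⬝ᵥ Q.theta ∂(Q.rho : Measure S)

/-- `π` is an optimal policy: it picks an action of largest mean reward in each state. -/
def IsOptimal (π : S → A) : Prop :=
  Admissible φ Q.rho π ∧ ∀ s a, φ s a ⬝ᵥ Q.theta ≤ φ s (π s) ⬝ᵥ Q.theta

/-- The optimal value (that of any optimal policy, if there is one). -/
def optValue : ℝ := sSup (Q.value '' {π | Admissible φ Q.rho π})

/-- The data matrix; its rows are the feature vectors of the covariates. -/
def dataMatrix : Matrix (Fin n) (Fin d) ℝ :=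
  Matrix.of fun i => φ (Q.cov i).1 (Q.cov i).2

/-- The sample second moment matrix `(1/n) ΦᵀΦ`. -/
def sigma : Matrix (Fin d) (Fin d) ℝ := (n : ℝ)⁻¹ • (Q.dataMatrixᵀ * Q.dataMatrix)

/-- `E_{s ∼ ρ} [φ(s, π(s))]`. -/
def meanFeature (π : S → A) : Fin d → ℝ := ∫ s, φ s (π s) ∂(Q.rho : Measure S)

/-- `‖Σ^{-1/2} E_{s ∼ ρ} [φ(s, π(s))]‖_q`. -/
def complexity (q : ℝ≥0∞) (π : S → A) : ℝ :=
  lpNormVec q (matInvSqrt Q.sigma *ᵥ Q.meanFeature π)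

/-- The ordinary least squares estimate computed from the rewards `r`. -/
def thetaOLS (r : Fin n → ℝ) : Fin d → ℝ :=
  (Q.dataMatrixᵀ * Q.dataMatrix)⁻¹ *ᵥ (Q.dataMatrixᵀ *ᵥ r)

/-- The `ℓ_p` confidence set of width parameter `β`. -/
def confSet (p : ℝ≥0∞) (β : ℝ) (r : Fin n → ℝ) : Set (Fin d → ℝ) :=
  {θ | lpNormVec p (matSqrt Q.sigma *ᵥ (θ - Q.thetaOLS r)) ≤ β / 2}

/-- The pessimistic value of `π`: the smallest value over the confidence set. -/
def pessValue (p : ℝ≥0∞) (β : ℝ) (r : Fin n → ℝ) (π : S → A) : ℝ :=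
  sInf ((fun θ => ∫ s, φ s (π s) ⬝ᵥ θ ∂(Q.rho : Measure S)) '' Q.confSet p β r)

/-- `π` is an output of the `ℓ_p` pessimistic rule of width `β` on the rewards `r`: it maximizes
the pessimistic value. -/
def IsPessimistic (p : ℝ≥0∞) (β : ℝ) (r : Fin n → ℝ) (π : S → A) : Prop :=
  Admissible φ Q.rho π ∧
    ∀ π', Admissible φ Q.rho π' → Q.pessValue p β r π' ≤ Q.pessValue p β r π

end Instance

/-- The class `CB_q(Λ)`, for instances with invertible `Σ`. If several policies are optimal, the
norm bound is required of all of them, so that the class is the smallest possible one over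
all ways of breaking ties. -/
def CB (φ : S → A → Fin d → ℝ) (n : ℕ) (q : ℝ≥0∞) (Λ : ℝ) : Set (Instance φ n) :=
  {Q | IsUnit Q.sigma.det ∧ (∃ π, Q.IsOptimal π) ∧
    ∀ π, Q.IsOptimal π → Q.complexity q π ≤ Λ}

/-- The class `CB_q(Λ)` without invertibility of `Σ`: the expected feature vector of an
optimal policy is in the range of `Σ`, and `Σ^{-1/2}` is the pseudo-inverse of `Σ^{1/2}`. -/
def CBPinv (φ : S → A → Fin d → ℝ) (n : ℕ) (q : ℝ≥0∞) (Λ : ℝ) : Set (Instance φ n) :=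
  {Q | (∃ π, Q.IsOptimal π) ∧
    ∀ π, Q.IsOptimal π →
      (∃ w, Q.sigma *ᵥ w = Q.meanFeature π) ∧ Q.complexity q π ≤ Λ}

/-- A learning rule for samples of size `n`: from the (known) test distribution, the covariates
and the observed rewards it computes a policy, measurably in the rewards. -/
structure LearningRule [MeasurableSpace A] (φ : S → A → Fin d → ℝ) (n : ℕ) where
  toFun : ProbabilityMeasure S → (Fin n → S × A) → (Fin n → ℝ) → S → A
  measurable : ∀ ρ cov, Measurable (toFun ρ cov)
  admissible : ∀ ρ cov r, Admissible φ ρ (toFun ρ cov r)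

/-- `E [V* - V(π̂)]`, the expected suboptimality of a learning rule in an instance. -/
def risk [MeasurableSpace A] {φ : S → A → Fin d → ℝ} {n : ℕ} (rule : LearningRule φ n)
    (Q : Instance φ n) : ℝ≥0∞ :=
  ∫⁻ r, ENNReal.ofReal (Q.optValue - Q.value (rule.toFun Q.rho Q.cov r)) ∂Q.rewardLaw

/-- `inf_{π̂} sup_{Q ∈ 𝒞} E_Q [V* - V(π̂)]`. -/
def minimaxRisk [MeasurableSpace A] {φ : S → A → Fin d → ℝ} {n : ℕ}
    (𝒞 : Set (Instance φ n)) : ℝ≥0∞ :=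
  ⨅ rule : LearningRule φ n, ⨆ Q ∈ 𝒞, risk rule Q

end OfflineCB

end

/-!
**Upper bounds.** Each coordinate of the rescaled error `Σ^{1/2} (θ̂ - θ)` is a weighted sum of the
centered rewards whose squared weights add up to `1 / n` (`sum_errorMatrix_sq`). Subgaussian tails
give a subgaussian moment generating function (`IsOneSubgaussian.hasSubgaussianMGF`), so Hoeffding's
inequality and a union bound put all coordinates below `8 √(log (d / δ) / n)` with probability
`1 - δ`. The `ℓ_p` confidence set then contains `θ`. The pessimistic value of the output is below its
true value and above the pessimistic value of the comparator, and Hölder's inequality bounds what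
the comparator loses by the width of the set times its complexity
(`Instance.IsPessimistic.value_sub_le`). For the `ℓ_∞` rule one passes from the `ℓ_1` to the
`ℓ_q` complexity at the cost of `d ^ (1 / p)` (`lpNormVec_one_le`).

**Lower bounds.** In the state `s` the features are `± sc s • e_{idx s}` and `0`, the parameter has
entries `± ε_j`, and the rewards are `±1`-valued. A coordinate which is observed `m` times with
`ε_j = 1 / √(2 m)` does not reveal its sign (`half_le_sum_signWeight`), so by averaging over the
signs some instance costs a quarter of `∫ sc s ε_{idx s} dρ` (`exists_risk_ge`). The matrix `Σ` is
diagonal, with the relative observation counts as its entries, so the complexity is explicit.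
With `ρ` uniform over the `d` coordinates, a complexity of at most `Λ` needs only
`m ≈ n / (d ^ (2 / p) Λ ^ 2)` observations of each coordinate, and the remaining observations are
spent on the feature `0`. For `q = 1` only one coordinate is tested. If moreover `Σ` is to be
invertible and `d ≤ n < 2 d`, the sample is too small to spread `m` freely: the tested coordinate is
observed once, and the scale of the test feature, taken from a dyadic grid built into the feature
mapping, is matched to `Λ / √n` up to a factor `2` instead (`le_minimaxRisk_CB_one`).
-/

noncomputable section

namespace OfflineCB

/-! ### Subgaussian tails and moment generating functions -/

lemma exp_le_add_exp_sq (x : ℝ) : Real.exp x ≤ x + Real.exp (x ^ 2) := by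
  have h1 := Real.add_one_le_exp (x ^ 2)
  rcases le_total |x| 1 with h | h
  · have := (abs_le.1 (Real.abs_exp_sub_one_sub_id_le h)).2
    linarith
  · rcases le_abs.1 h with h | h
    · have : Real.exp x ≤ Real.exp (x ^ 2) := Real.exp_le_exp.2 (by nlinarith)
      linarith
    · have : Real.exp x ≤ 1 := Real.exp_le_one_iff.2 (by linarith)
      nlinarith

lemma integral_half_mul_exp_sq (y : ℝ) :
    ∫ t in (0 : ℝ)..y, t / 2 * Real.exp (t ^ 2 / 4) = Real.exp (y ^ 2 / 4) - 1 := by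
  have h : ∀ t ∈ Set.uIcc 0 y, HasDerivAt (fun t : ℝ => Real.exp (t ^ 2 / 4))
      (t / 2 * Real.exp (t ^ 2 / 4)) t := fun t _ => by
    have := ((hasDerivAt_pow 2 t).div_const 4).exp
    convert this using 1
    norm_num
    ring
  rw [intervalIntegral.integral_eq_sub_of_hasDerivAt h
    (Continuous.intervalIntegrable (by fun_prop) _ _)]
  simp

lemma lintegral_Ioi_mul_exp_neg_sq :
    ∫⁻ t in Set.Ioi (0 : ℝ), ENNReal.ofReal (t * Real.exp (-t ^ 2 / 4)) = ENNReal.ofReal 2 := by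
  have h : ∀ t ∈ Set.Ici (0 : ℝ), HasDerivAt (fun t : ℝ => -2 * Real.exp (-t ^ 2 / 4))
      (t * Real.exp (-t ^ 2 / 4)) t := fun t _ => by
    refine ((((hasDerivAt_pow 2 t).fun_neg.div_const 4).exp).const_mul (-2)).congr_deriv ?_
    norm_num
    ring
  have hpos : ∀ t ∈ Set.Ioi (0 : ℝ), 0 ≤ t * Real.exp (-t ^ 2 / 4) := fun t ht =>
    mul_nonneg (le_of_lt ht) (Real.exp_pos _).le
  have hlim : Filter.Tendsto (fun t : ℝ => -2 * Real.exp (-t ^ 2 / 4)) Filter.atTop (nhds 0) := by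
    have h2 : Filter.Tendsto (fun t : ℝ => -t ^ 2 / 4) Filter.atTop Filter.atBot := by
      have := (Filter.tendsto_pow_atTop (α := ℝ) two_ne_zero).const_mul_atTop_of_neg
        (show (-1 / 4 : ℝ) < 0 by norm_num)
      refine this.congr fun t => ?_
      ring
    simpa using (Real.tendsto_exp_atBot.comp h2).const_mul (-2)
  have hint := integrableOn_Ioi_deriv_of_nonneg' h hpos hlim
  rw [← ofReal_integral_eq_lintegral_ofReal hint
    ((ae_restrict_iff' measurableSet_Ioi).2 (Filter.Eventually.of_forall hpos)),
    integral_Ioi_of_hasDerivAt_of_nonneg' h hpos hlim]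
  norm_num

/-- The subgaussian tail bounds the square-exponential moment, by the layer cake formula. -/
lemma IsOneSubgaussian.lintegral_exp_sq_le {μ : Measure ℝ} [IsProbabilityMeasure μ]
    (h : IsOneSubgaussian μ) :
    ∫⁻ x, ENNReal.ofReal (Real.exp ((x - ∫ y, y ∂μ) ^ 2 / 4)) ∂μ ≤ ENNReal.ofReal 3 := by
  set m := ∫ y, y ∂μ
  have e : ∀ x : ℝ, ENNReal.ofReal (Real.exp ((x - m) ^ 2 / 4)) =
      ENNReal.ofReal (∫ t in (0 : ℝ)..|x - m|, t / 2 * Real.exp (t ^ 2 / 4)) + 1 := fun x => by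
    have h1 : 1 ≤ Real.exp ((x - m) ^ 2 / 4) := Real.one_le_exp (by positivity)
    rw [integral_half_mul_exp_sq, sq_abs, ← ENNReal.ofReal_one,
      ← ENNReal.ofReal_add (by linarith) zero_le_one, sub_add_cancel]
  simp_rw [e]
  rw [lintegral_add_right _ measurable_const, lintegral_comp_eq_lintegral_meas_le_mul_of_measurable
    (f := fun x => |x - m|) μ (fun x => abs_nonneg _) (by fun_prop)
    (fun t _ => Continuous.intervalIntegrable (by fun_prop) _ _) (by fun_prop)
    (fun t ht => by positivity)]
  have h3 : ∫⁻ t in Set.Ioi (0 : ℝ), μ {a : ℝ | t ≤ |a - m|} *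
      ENNReal.ofReal (t / 2 * Real.exp (t ^ 2 / 4)) ≤ ENNReal.ofReal 2 := by
    rw [← lintegral_Ioi_mul_exp_neg_sq]
    refine setLIntegral_mono (by fun_prop) fun t ht => ?_
    refine (mul_le_mul' (h t (le_of_lt ht)) le_rfl).trans (le_of_eq ?_)
    rw [← ENNReal.ofReal_mul (by positivity)]
    congr 1
    rw [show -t ^ 2 / 4 = -t ^ 2 / 2 + t ^ 2 / 4 by ring, Real.exp_add]
    ring
  calc _ ≤ ENNReal.ofReal 2 + 1 := by simpa using h3
    _ = _ := by
      rw [← ENNReal.ofReal_one, ← ENNReal.ofReal_add] <;> norm_num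

/-- Subgaussian tails give a subgaussian moment generating function, with variance proxy `16`.
For small arguments `t` the bound `exp x ≤ x + exp (x ^ 2)` and centering leave
`E exp (t ^ 2 Y ^ 2)`, which convexity compares with `E exp (Y ^ 2 / 4)`; for large ones
`t Y ≤ t ^ 2 + Y ^ 2 / 4` suffices. -/
lemma IsOneSubgaussian.hasSubgaussianMGF {μ : Measure ℝ} [IsProbabilityMeasure μ]
    (h : IsOneSubgaussian μ) (hi : Integrable (fun x : ℝ => x) μ) :
    ProbabilityTheory.HasSubgaussianMGF (fun x => x - ∫ y, y ∂μ) 16 μ := by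
  have hl := h.lintegral_exp_sq_le
  set m := ∫ y, y ∂μ with hm
  have hint : Integrable (fun x => Real.exp ((x - m) ^ 2 / 4)) μ := by
    refine ⟨by fun_prop, ?_⟩
    rw [hasFiniteIntegral_iff_ofReal (Filter.Eventually.of_forall fun x => (Real.exp_pos _).le)]
    exact hl.trans_lt ENNReal.ofReal_lt_top
  have hE : ∫ x, Real.exp ((x - m) ^ 2 / 4) ∂μ ≤ 3 := by
    rw [integral_eq_lintegral_of_nonneg_ae
      (Filter.Eventually.of_forall fun x => (Real.exp_pos _).le) (by fun_prop)]
    exact ENNReal.toReal_le_of_le_ofReal (by norm_num) hl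
  have hyoung : ∀ t x : ℝ, Real.exp (t * (x - m)) ≤
      Real.exp (t ^ 2) * Real.exp ((x - m) ^ 2 / 4) := fun t x => by
    rw [← Real.exp_add]
    exact Real.exp_le_exp.2 (by nlinarith [sq_nonneg (t - (x - m) / 2)])
  have hexp : ∀ t : ℝ, Integrable (fun x => Real.exp (t * (x - m))) μ := fun t =>
    (hint.const_mul (Real.exp (t ^ 2))).mono' (by fun_prop)
      (Filter.Eventually.of_forall fun x => by
        rw [Real.norm_of_nonneg (Real.exp_pos _).le]; exact hyoung t x)
  refine ⟨hexp, fun t => ?_⟩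
  rw [ProbabilityTheory.mgf]
  have e16 : Real.exp (((16 : NNReal) : ℝ) * t ^ 2 / 2) = Real.exp (8 * t ^ 2) := by
    congr 1; push_cast; ring
  rw [e16]
  rcases le_total (4 * t ^ 2) 1 with ht | ht
  · have hc : Integrable (fun x => x - m) μ := hi.sub (integrable_const _)
    have hz : ∫ x, (x - m) ∂μ = 0 := by
      rw [integral_sub hi (integrable_const _)]; simp [← hm]
    have hb : ∀ x, Real.exp (t * (x - m)) ≤ t * (x - m) +
        ((1 - 4 * t ^ 2) + 4 * t ^ 2 * Real.exp ((x - m) ^ 2 / 4)) := fun x => by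
      refine (exp_le_add_exp_sq _).trans (add_le_add le_rfl ?_)
      have := convexOn_exp.2 (Set.mem_univ 0) (Set.mem_univ ((x - m) ^ 2 / 4))
        (sub_nonneg.2 ht) (by positivity : 0 ≤ 4 * t ^ 2) (by ring)
      simp only [smul_eq_mul, mul_zero, zero_add, Real.exp_zero, mul_one] at this
      refine le_trans (le_of_eq ?_) this
      congr 1; ring
    have hb' : Integrable (fun x => (1 - 4 * t ^ 2) + 4 * t ^ 2 * Real.exp ((x - m) ^ 2 / 4)) μ :=
      (integrable_const _).add (hint.const_mul _)
    calc _ ≤ ∫ x, (t * (x - m) +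
        ((1 - 4 * t ^ 2) + 4 * t ^ 2 * Real.exp ((x - m) ^ 2 / 4))) ∂μ :=
          integral_mono (hexp t) ((hc.const_mul t).add hb') hb
      _ = (1 - 4 * t ^ 2) + 4 * t ^ 2 * ∫ x, Real.exp ((x - m) ^ 2 / 4) ∂μ := by
          rw [integral_add (hc.const_mul t) hb', integral_const_mul, hz,
            integral_add (integrable_const _) (hint.const_mul _), integral_const_mul]
          simp
      _ ≤ 8 * t ^ 2 + 1 := by nlinarith [sq_nonneg t]
      _ ≤ _ := Real.add_one_le_exp _
  · calc _ ≤ ∫ x, Real.exp (t ^ 2) * Real.exp ((x - m) ^ 2 / 4) ∂μ :=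
          integral_mono (hexp t) (hint.const_mul _) (hyoung t)
      _ ≤ Real.exp (t ^ 2) * 3 := by
          rw [integral_const_mul]
          exact mul_le_mul_of_nonneg_left hE (Real.exp_pos _).le
      _ ≤ Real.exp (t ^ 2) * Real.exp (7 * t ^ 2) := by
          refine mul_le_mul_of_nonneg_left ?_ (Real.exp_pos _).le
          have := Real.quadratic_le_exp_of_nonneg (by positivity : 0 ≤ 7 * t ^ 2)
          nlinarith
      _ = _ := by rw [← Real.exp_add]; congr 1; ring

/-! ### The `ℓ_p` norms -/

section NormsAndRoots

variable {d : ℕ}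

lemma lpNormVec_top (v : Fin d → ℝ) : lpNormVec ∞ v = ⨆ i, |v i| := rfl

lemma lpNormVec_eq_sum {p : ℝ≥0∞} (hp : 1 ≤ p) (hp' : p ≠ ∞) (v : Fin d → ℝ) :
    lpNormVec p v = (∑ i, |v i| ^ p.toReal) ^ (1 / p.toReal) :=
  PiLp.norm_eq_sum (ENNReal.toReal_pos (by positivity) hp') _

lemma lpNormVec_one (v : Fin d → ℝ) : lpNormVec 1 v = ∑ i, |v i| := by
  simp [lpNormVec_eq_sum le_rfl ENNReal.one_ne_top]

lemma lpNormVec_nonneg {p : ℝ≥0∞} (hp : 1 ≤ p) (v : Fin d → ℝ) : 0 ≤ lpNormVec p v := by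
  have : Fact (1 ≤ p) := ⟨hp⟩
  exact norm_nonneg _

lemma lpNormVec_add_le {p : ℝ≥0∞} (hp : 1 ≤ p) (v w : Fin d → ℝ) :
    lpNormVec p (v + w) ≤ lpNormVec p v + lpNormVec p w := by
  have : Fact (1 ≤ p) := ⟨hp⟩
  exact norm_add_le (WithLp.toLp p v) (WithLp.toLp p w)

lemma lpNormVec_neg {p : ℝ≥0∞} (hp : 1 ≤ p) (v : Fin d → ℝ) :
    lpNormVec p (-v) = lpNormVec p v := by
  have : Fact (1 ≤ p) := ⟨hp⟩
  exact norm_neg (WithLp.toLp p v)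

lemma abs_le_lpNormVec_top (v : Fin d → ℝ) (i : Fin d) : |v i| ≤ lpNormVec ∞ v :=
  le_ciSup (f := fun i => |v i|) (Set.finite_range _).bddAbove i

/-- **Hölder's inequality** for dual exponents, the endpoints included. -/
lemma dotProduct_le_lpNormVec {p q : ℝ≥0∞} (hp : 1 ≤ p) (hq : 1 ≤ q) (hpq : p⁻¹ + q⁻¹ = 1)
    (v w : Fin d → ℝ) : v ⬝ᵥ w ≤ lpNormVec q v * lpNormVec p w := by
  have top_one : ∀ v w : Fin d → ℝ, v ⬝ᵥ w ≤ lpNormVec ∞ v * lpNormVec 1 w := fun v w => by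
    rw [lpNormVec_one, Finset.mul_sum]
    refine Finset.sum_le_sum fun i _ => (le_abs_self _).trans ?_
    rw [abs_mul]
    exact mul_le_mul_of_nonneg_right (abs_le_lpNormVec_top v i) (abs_nonneg _)
  by_cases hp' : p = ∞
  · have : q = 1 := by simpa [hp'] using hpq
    subst hp' this
    rw [dotProduct_comm, mul_comm]
    exact top_one w v
  by_cases hq' : q = ∞
  · have : p = 1 := by simpa [hq'] using hpq
    subst hq' this
    exact top_one v w
  have hp0 := ENNReal.toReal_pos (by positivity) hp'
  have hq0 := ENNReal.toReal_pos (by positivity) hq'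
  have hr : q.toReal.HolderConjugate p.toReal := by
    have h := congrArg ENNReal.toReal hpq
    rw [ENNReal.toReal_add (by simp; positivity) (by simp; positivity), ENNReal.toReal_inv,
      ENNReal.toReal_inv, ENNReal.toReal_one] at h
    exact ⟨by rw [add_comm, h, inv_one], hq0, hp0⟩
  rw [lpNormVec_eq_sum hp hp', lpNormVec_eq_sum hq hq']
  exact Real.inner_le_Lp_mul_Lq Finset.univ v w hr

/-- If the entries are at most `M`, then `‖v‖_p ≤ d ^ (1 / p) M`. -/
lemma lpNormVec_le_of_forall_abs_le {p : ℝ≥0∞} (hp : 1 ≤ p) {v : Fin d → ℝ} {M : ℝ} (hM : 0 ≤ M)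
    (h : ∀ i, |v i| ≤ M) : lpNormVec p v ≤ (d : ℝ) ^ (p⁻¹).toReal * M := by
  by_cases hp' : p = ∞
  · subst hp'
    rw [lpNormVec_top]
    simpa using Real.iSup_le h hM
  have hp0 := ENNReal.toReal_pos (by positivity) hp'
  rw [lpNormVec_eq_sum hp hp']
  calc (∑ i, |v i| ^ p.toReal) ^ (1 / p.toReal)
      ≤ (∑ _i : Fin d, M ^ p.toReal) ^ (1 / p.toReal) :=
        Real.rpow_le_rpow (Finset.sum_nonneg fun i _ => by positivity)
          (Finset.sum_le_sum fun i _ => Real.rpow_le_rpow (abs_nonneg _) (h i) hp0.le)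
          (by positivity)
    _ = _ := by
        rw [Finset.sum_const, Finset.card_univ, Fintype.card_fin, nsmul_eq_mul,
          Real.mul_rpow (by positivity) (by positivity), ← Real.rpow_mul hM,
          mul_one_div_cancel hp0.ne', Real.rpow_one, ENNReal.toReal_inv, one_div]

/-- `‖v‖_1 ≤ d ^ (1 / p) ‖v‖_q` for dual exponents: Hölder's inequality against the signs. -/
lemma lpNormVec_one_le {p q : ℝ≥0∞} (hp : 1 ≤ p) (hq : 1 ≤ q) (hpq : p⁻¹ + q⁻¹ = 1)
    (v : Fin d → ℝ) : lpNormVec 1 v ≤ (d : ℝ) ^ (p⁻¹).toReal * lpNormVec q v := by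
  have h1 : lpNormVec 1 v = v ⬝ᵥ fun i => (SignType.sign (v i) : ℝ) := by
    rw [lpNormVec_one]
    exact Finset.sum_congr rfl fun i _ => (self_mul_sign (v i)).symm
  have h2 : lpNormVec p (fun i => (SignType.sign (v i) : ℝ)) ≤ (d : ℝ) ^ (p⁻¹).toReal * 1 := by
    refine lpNormVec_le_of_forall_abs_le hp zero_le_one fun i => ?_
    rcases SignType.sign (v i) with _ | _ | _ <;> simp
  rw [h1, mul_comm]
  refine (dotProduct_le_lpNormVec hp hq hpq _ _).trans ?_
  exact mul_le_mul_of_nonneg_left (by simpa using h2) (lpNormVec_nonneg hq v)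

/-! ### Square roots of positive definite matrices -/

lemma continuousOn_spectrum (M : Matrix (Fin d) (Fin d) ℝ) (f : ℝ → ℝ) :
    ContinuousOn f (spectrum ℝ M) :=
  (Matrix.finite_spectrum M).continuousOn f

lemma spectrum_pos {M : Matrix (Fin d) (Fin d) ℝ} (hM : M.PosDef) {x : ℝ}
    (hx : x ∈ spectrum ℝ M) : 0 < x := by
  rw [hM.1.spectrum_real_eq_range_eigenvalues] at hx
  obtain ⟨i, rfl⟩ := hx
  exact hM.eigenvalues_pos i

lemma matInvSqrt_transpose (M : Matrix (Fin d) (Fin d) ℝ) : (matInvSqrt M)ᵀ = matInvSqrt M := by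
  have : IsSelfAdjoint (matInvSqrt M) := cfc_predicate _ _
  simpa [IsSelfAdjoint, Matrix.star_eq_conjTranspose, Matrix.conjTranspose_eq_transpose_of_trivial]
    using this

lemma matInvSqrt_mul_matSqrt {M : Matrix (Fin d) (Fin d) ℝ} (hM : M.PosDef) :
    matInvSqrt M * matSqrt M = 1 := by
  have hs : IsSelfAdjoint M := hM.1
  rw [matInvSqrt, matSqrt, ← cfc_mul _ _ M (continuousOn_spectrum M _) (continuousOn_spectrum M _),
    ← cfc_one ℝ M]
  refine cfc_congr fun x hx => ?_
  exact inv_mul_cancel₀ (Real.sqrt_pos.2 (spectrum_pos hM hx)).ne'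

lemma matInvSqrt_mul_mul_matInvSqrt {M : Matrix (Fin d) (Fin d) ℝ} (hM : M.PosDef) :
    matInvSqrt M * M * matInvSqrt M = 1 := by
  have hs : IsSelfAdjoint M := hM.1
  have h : M = matSqrt M * matSqrt M := by
    conv_lhs => rw [← cfc_id ℝ M]
    rw [matSqrt, ← cfc_mul _ _ M (continuousOn_spectrum M _) (continuousOn_spectrum M _)]
    exact cfc_congr fun x hx => (Real.mul_self_sqrt (spectrum_pos hM hx).le).symm
  have h1 := matInvSqrt_mul_matSqrt hM
  have h2 : matSqrt M * matInvSqrt M = 1 := mul_eq_one_comm.1 h1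
  calc _ = matInvSqrt M * (matSqrt M * matSqrt M) * matInvSqrt M := by rw [← h]
    _ = (matInvSqrt M * matSqrt M) * (matSqrt M * matInvSqrt M) := by simp only [mul_assoc]
    _ = 1 := by rw [h1, h2, mul_one]

lemma aeval_diagonal (w : Fin d → ℝ) (P : Polynomial ℝ) :
    Polynomial.aeval (Matrix.diagonal w) P = Matrix.diagonal fun i => P.eval (w i) := by
  have h := Polynomial.aeval_algHom_apply (Matrix.diagonalAlgHom (n := Fin d) (α := ℝ) ℝ) w P
  rw [Matrix.diagonalAlgHom_apply, Matrix.diagonalAlgHom_apply] at h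
  rw [h]
  congr 1
  funext i
  have := Polynomial.aeval_algHom_apply (Pi.evalAlgHom ℝ (fun _ : Fin d => ℝ) i) w P
  exact this.symm

/-- The functional calculus acts entrywise on diagonal matrices. The spectrum is finite, so
`x ↦ (√x)⁻¹` may be replaced by an interpolating polynomial. -/
lemma matInvSqrt_diagonal (w : Fin d → ℝ) :
    matInvSqrt (Matrix.diagonal w) = Matrix.diagonal fun i => (Real.sqrt (w i))⁻¹ := by
  classical
  set P := Lagrange.interpolate (Finset.univ.image w) id fun x => (Real.sqrt x)⁻¹
  have hP : ∀ i, P.eval (w i) = (Real.sqrt (w i))⁻¹ := fun i =>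
    Lagrange.eval_interpolate_at_node _ (Function.injective_id.injOn) (by simp)
  have hs : IsSelfAdjoint (Matrix.diagonal w) := Matrix.isHermitian_diagonal w
  have h : matInvSqrt (Matrix.diagonal w) = cfc P.eval (Matrix.diagonal w) := by
    refine cfc_congr fun x hx => ?_
    rw [spectrum_diagonal] at hx
    obtain ⟨i, rfl⟩ := hx
    exact (hP i).symm
  rw [h, cfc_polynomial P (Matrix.diagonal w) hs, aeval_diagonal]
  simp_rw [hP]

end NormsAndRoots

/-! ### Deviations of the least squares estimate -/

/-- Hoeffding's inequality for weighted sums of independent `1`-subgaussian variables. -/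
lemma pi_abs_sum_ge_le {n : ℕ} (μ : Fin n → ProbabilityMeasure ℝ)
    (hi : ∀ i, Integrable (fun x : ℝ => x) (μ i : Measure ℝ))
    (hs : ∀ i, IsOneSubgaussian (μ i : Measure ℝ)) (u : Fin n → ℝ) {t : ℝ} (ht : 0 ≤ t) :
    Measure.pi (fun i => (μ i : Measure ℝ))
      {r | t ≤ |∑ i, u i * (r i - ∫ y, y ∂(μ i : Measure ℝ))|} ≤
      ENNReal.ofReal (2 * Real.exp (-t ^ 2 / (32 * ∑ i, u i ^ 2))) := by
  set P := Measure.pi (fun i => (μ i : Measure ℝ))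
  have key : ∀ w : Fin n → ℝ, P {r | t ≤ ∑ i, w i * (r i - ∫ y, y ∂(μ i : Measure ℝ))} ≤
      ENNReal.ofReal (Real.exp (-t ^ 2 / (32 * ∑ i, w i ^ 2))) := fun w => by
    have hind : ProbabilityTheory.iIndepFun
        (fun i (r : Fin n → ℝ) => w i * (r i - ∫ y, y ∂(μ i : Measure ℝ))) P :=
      ProbabilityTheory.iIndepFun_pi (X := fun i x => w i * (x - ∫ y, y ∂(μ i : Measure ℝ)))
        fun i => by fun_prop
    have hsub : ∀ i ∈ Finset.univ, ProbabilityTheory.HasSubgaussianMGF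
        (fun r : Fin n → ℝ => w i * (r i - ∫ y, y ∂(μ i : Measure ℝ)))
        (Real.toNNReal (w i ^ 2) * 16) P := fun i _ => by
      have h : ProbabilityTheory.HasSubgaussianMGF
          (fun x => w i * (x - ∫ y, y ∂(μ i : Measure ℝ))) (Real.toNNReal (w i ^ 2) * 16)
          (μ i : Measure ℝ) := by
        rw [Real.toNNReal_of_nonneg (sq_nonneg _)]
        exact ((hs i).hasSubgaussianMGF (hi i)).const_mul (w i)
      have hmap : P.map (fun r => r i) = (μ i : Measure ℝ) :=
        (measurePreserving_eval (fun i => (μ i : Measure ℝ)) i).map_eq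
      refine ProbabilityTheory.HasSubgaussianMGF.of_map (Y := fun r : Fin n → ℝ => r i)
        (X := fun x => w i * (x - ∫ y, y ∂(μ i : Measure ℝ)))
        (measurable_pi_apply i).aemeasurable ?_
      rw [hmap]
      exact h
    have := ProbabilityTheory.HasSubgaussianMGF.measure_sum_ge_le_of_iIndepFun hind hsub ht
    rw [Measure.real] at this
    refine (ENNReal.le_ofReal_iff_toReal_le (measure_ne_top _ _) (Real.exp_pos _).le).2
      (this.trans (le_of_eq ?_))
    congr 2
    push_cast
    simp_rw [Real.coe_toNNReal _ (sq_nonneg (w _)), ← Finset.sum_mul]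
    ring
  calc _ ≤ P ({r | t ≤ ∑ i, u i * (r i - ∫ y, y ∂(μ i : Measure ℝ))} ∪
        {r | t ≤ ∑ i, (-u i) * (r i - ∫ y, y ∂(μ i : Measure ℝ))}) := by
        refine measure_mono fun r hr => ?_
        rcases le_abs.1 (show t ≤ |_| from hr) with h | h
        · exact Or.inl h
        · refine Or.inr ?_
          simpa [neg_mul, Finset.sum_neg_distrib] using h
    _ ≤ _ := (measure_union_le _ _).trans (add_le_add (key u) (key fun i => -u i))
    _ = _ := by
        simp only [neg_sq]
        rw [← ENNReal.ofReal_add (Real.exp_pos _).le (Real.exp_pos _).le, two_mul]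

section UpperBounds

variable {S A : Type*} [MeasurableSpace S] {d : ℕ}

namespace Instance

variable {φ : S → A → Fin d → ℝ} {n : ℕ} (Q : Instance φ n)

lemma sigma_posSemidef : Q.sigma.PosSemidef := by
  have := Matrix.posSemidef_conjTranspose_mul_self Q.dataMatrix
  rw [Matrix.conjTranspose_eq_transpose_of_trivial] at this
  exact this.smul (by positivity : (0 : ℝ) ≤ (n : ℝ)⁻¹)

variable {Q}

lemma sigma_posDef (hQ : IsUnit Q.sigma.det) : Q.sigma.PosDef :=
  Q.sigma_posSemidef.posDef_iff_isUnit.2 ((Matrix.isUnit_iff_isUnit_det _).2 hQ)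

lemma sample_size_pos (hd : 0 < d) (hQ : IsUnit Q.sigma.det) : 0 < n := by
  rcases Nat.eq_zero_or_pos n with rfl | h
  · have : Nonempty (Fin d) := ⟨⟨0, hd⟩⟩
    simp [sigma] at hQ
  · exact h

variable (Q) in
/-- The matrix `n⁻¹ Σ^{-1/2} Φᵀ`, which maps the noise vector to the rescaled error
`Σ^{1/2} (θ̂ - θ)` of the least squares estimate. -/
def errorMatrix : Matrix (Fin d) (Fin n) ℝ :=
  (n : ℝ)⁻¹ • (matInvSqrt Q.sigma * Q.dataMatrixᵀ)

lemma matSqrt_mulVec_thetaOLS_sub (hn : 0 < n) (hQ : IsUnit Q.sigma.det) (r : Fin n → ℝ) :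
    matSqrt Q.sigma *ᵥ (Q.thetaOLS r - Q.theta) =
      Q.errorMatrix *ᵥ (r - Q.dataMatrix *ᵥ Q.theta) := by
  have hn' : (n : ℝ) ≠ 0 := by positivity
  have hp := sigma_posDef hQ
  have h1 := matInvSqrt_mul_matSqrt hp
  have h2 : matSqrt Q.sigma * matInvSqrt Q.sigma = 1 := mul_eq_one_comm.1 h1
  have h3 := matInvSqrt_mul_mul_matInvSqrt hp
  have hG : Q.dataMatrixᵀ * Q.dataMatrix = (n : ℝ) • Q.sigma := by
    rw [sigma, smul_smul, mul_inv_cancel₀ hn', one_smul]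
  have hinv : (Q.dataMatrixᵀ * Q.dataMatrix)⁻¹ =
      (n : ℝ)⁻¹ • (matInvSqrt Q.sigma * matInvSqrt Q.sigma) := by
    refine Matrix.inv_eq_left_inv ?_
    rw [hG, Matrix.smul_mul, Matrix.mul_smul, smul_smul, inv_mul_cancel₀ hn', one_smul, mul_assoc]
    exact mul_eq_one_comm.1 h3
  have hdet : IsUnit (Q.dataMatrixᵀ * Q.dataMatrix).det := by
    rw [hG, Matrix.det_smul]
    exact (IsUnit.mk0 _ (pow_ne_zero _ hn')).mul hQ
  have hr : Q.thetaOLS r - Q.theta =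
      (Q.dataMatrixᵀ * Q.dataMatrix)⁻¹ *ᵥ (Q.dataMatrixᵀ *ᵥ (r - Q.dataMatrix *ᵥ Q.theta)) := by
    rw [Matrix.mulVec_sub, Matrix.mulVec_sub, Matrix.mulVec_mulVec Q.theta,
      Matrix.mulVec_mulVec Q.theta, Matrix.nonsing_inv_mul _ hdet, Matrix.one_mulVec]
    rfl
  rw [hr, hinv, errorMatrix, Matrix.mulVec_mulVec, Matrix.mulVec_mulVec]
  congr 1
  rw [Matrix.mul_smul, Matrix.smul_mul, ← mul_assoc, h2, one_mul]

lemma sum_errorMatrix_sq (hQ : IsUnit Q.sigma.det) (j : Fin d) :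
    ∑ i, Q.errorMatrix j i ^ 2 = (n : ℝ)⁻¹ := by
  have h : Q.errorMatrix * Q.errorMatrixᵀ = (n : ℝ)⁻¹ • 1 := by
    rw [← matInvSqrt_mul_mul_matInvSqrt (sigma_posDef hQ)]
    rw [errorMatrix, Matrix.transpose_smul, Matrix.transpose_mul, Matrix.transpose_transpose,
      matInvSqrt_transpose, Matrix.smul_mul, Matrix.mul_smul]
    rw [show matInvSqrt Q.sigma * Q.sigma = (n : ℝ)⁻¹ • (matInvSqrt Q.sigma *
      (Q.dataMatrixᵀ * Q.dataMatrix)) from Matrix.mul_smul _ _ _, Matrix.smul_mul]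
    simp only [Matrix.mul_assoc]
  have := congrFun (congrFun h j) j
  simpa [Matrix.mul_apply, sq] using this

/-- With probability at least `1 - δ` all coordinates of `Σ^{1/2} (θ̂ - θ)` are small. -/
lemma rewardLaw_exists_coord_ge_le (hd : 2 ≤ d) (hQ : IsUnit Q.sigma.det) {δ : ℝ} (hδ : 0 < δ)
    (hδ' : δ < 1) :
    Q.rewardLaw {r | ∃ j, 8 * Real.sqrt (Real.log (d / δ) / n) ≤
      |(matSqrt Q.sigma *ᵥ (Q.thetaOLS r - Q.theta)) j|} ≤ ENNReal.ofReal δ := by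
  have hn := sample_size_pos (by omega) hQ
  have hn' : (0 : ℝ) < n := by exact_mod_cast hn
  have hd' : (2 : ℝ) ≤ d := by exact_mod_cast hd
  have hL : 0 ≤ Real.log (d / δ) := Real.log_nonneg (by rw [le_div_iff₀ hδ]; linarith)
  set t := 8 * Real.sqrt (Real.log (d / δ) / n) with ht
  have ht0 : 0 ≤ t := by positivity
  have hj : ∀ j, Q.rewardLaw {r | t ≤ |(matSqrt Q.sigma *ᵥ (Q.thetaOLS r - Q.theta)) j|} ≤
      ENNReal.ofReal (2 * (δ / d) ^ 2) := fun j => by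
    have h := pi_abs_sum_ge_le (fun i => Q.R (Q.cov i).1 (Q.cov i).2)
      (fun i => Q.integrable_R _ _) (fun i => Q.subgaussian_R _ _) (Q.errorMatrix j) ht0
    rw [sum_errorMatrix_sq hQ] at h
    -- the factor `8` makes each coordinate fail with probability at most `2 (δ / d) ^ 2`, and
    -- `d ≥ 2` then pays for both sides and all `d` coordinates
    have e1 : -t ^ 2 / (32 * (n : ℝ)⁻¹) = 2 * Real.log (δ / d) := by
      rw [ht, mul_pow, Real.sq_sqrt (by positivity), ← inv_div δ (d : ℝ), Real.log_inv]
      field_simp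
      ring
    have e2 : Real.exp (2 * Real.log (δ / d)) = (δ / d) ^ 2 := by
      rw [mul_comm, Real.exp_mul, Real.exp_log (by positivity)]
      norm_cast
    rw [e1, e2] at h
    refine le_trans (le_of_eq ?_) h
    congr 1
    ext r
    simp only [Set.mem_ofPred_eq]
    rw [matSqrt_mulVec_thetaOLS_sub hn hQ]
    simp only [Q.mean_R]
    rfl
  calc _ ≤ ∑ j, Q.rewardLaw {r | t ≤ |(matSqrt Q.sigma *ᵥ (Q.thetaOLS r - Q.theta)) j|} := by
        refine le_trans (le_of_eq ?_) (measure_iUnion_fintype_le _ _)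
        congr 1
        ext r
        simp
    _ ≤ ∑ _j : Fin d, ENNReal.ofReal (2 * (δ / d) ^ 2) := Finset.sum_le_sum fun j _ => hj j
    _ = ENNReal.ofReal (d * (2 * (δ / d) ^ 2)) := by
        rw [Finset.sum_const, Finset.card_univ, Fintype.card_fin, nsmul_eq_mul,
          ENNReal.ofReal_mul (by positivity : (0 : ℝ) ≤ d), ENNReal.ofReal_natCast]
    _ ≤ _ := by
        refine ENNReal.ofReal_le_ofReal ?_
        have : d * (2 * (δ / d) ^ 2) = 2 * δ ^ 2 / d := by field_simp
        rw [this, div_le_iff₀ (by positivity)]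
        nlinarith

/-! ### Pessimism -/

variable (Q) in
lemma integral_dotProduct {π : S → A} (hπ : Admissible φ Q.rho π) (θ : Fin d → ℝ) :
    ∫ s, φ s (π s) ⬝ᵥ θ ∂(Q.rho : Measure S) = Q.meanFeature π ⬝ᵥ θ := by
  have h : ∀ i, Integrable (fun s => φ s (π s) i) (Q.rho : Measure S) := fun i => hπ.eval i
  simp only [dotProduct, meanFeature]
  rw [integral_finsetSum _ fun i _ => (h i).mul_const _]
  refine Finset.sum_congr rfl fun i _ => ?_
  rw [integral_mul_const, eval_integral h]

lemma meanFeature_dotProduct_le {p q : ℝ≥0∞} (hp : 1 ≤ p) (hq : 1 ≤ q) (hpq : p⁻¹ + q⁻¹ = 1)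
    (hQ : IsUnit Q.sigma.det) (π : S → A) (θ : Fin d → ℝ) :
    Q.meanFeature π ⬝ᵥ θ ≤ Q.complexity q π * lpNormVec p (matSqrt Q.sigma *ᵥ θ) := by
  refine le_trans (le_of_eq ?_) (dotProduct_le_lpNormVec hp hq hpq _ _)
  have h : matInvSqrt Q.sigma *ᵥ Q.meanFeature π = Q.meanFeature π ᵥ* matInvSqrt Q.sigma := by
    rw [← Matrix.mulVec_transpose, matInvSqrt_transpose]
  rw [h, ← Matrix.dotProduct_mulVec, Matrix.mulVec_mulVec,
    matInvSqrt_mul_matSqrt (sigma_posDef hQ), Matrix.one_mulVec]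

/-- The regret of a pessimistic policy is at most the width of the confidence set times the
complexity of the comparator, as soon as the confidence set contains the parameter. -/
lemma IsPessimistic.value_sub_le {p q : ℝ≥0∞} (hp : 1 ≤ p) (hq : 1 ≤ q) (hpq : p⁻¹ + q⁻¹ = 1)
    (hQ : IsUnit Q.sigma.det) {β : ℝ} {r : Fin n → ℝ} (hθ : Q.theta ∈ Q.confSet p β r)
    {π π' : S → A} (hπ : Q.IsPessimistic p β r π) (hπ' : Admissible φ Q.rho π') :
    Q.value π' - Q.value π ≤ Q.complexity q π' * β := by
  have hdiff : ∀ θ ∈ Q.confSet p β r, ∀ θ' ∈ Q.confSet p β r,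
      lpNormVec p (matSqrt Q.sigma *ᵥ (θ - θ')) ≤ β := fun θ h θ' h' => by
    have e : matSqrt Q.sigma *ᵥ (θ - θ') = matSqrt Q.sigma *ᵥ (θ - Q.thetaOLS r) +
        -(matSqrt Q.sigma *ᵥ (θ' - Q.thetaOLS r)) := by
      rw [← Matrix.mulVec_neg, ← Matrix.mulVec_add]
      congr 1
      abel
    rw [e]
    refine (lpNormVec_add_le hp _ _).trans ?_
    rw [lpNormVec_neg hp]
    have h1 : _ ≤ β / 2 := h
    have h2 : _ ≤ β / 2 := h'
    linarith
  have hvar : ∀ π : S → A, ∀ θ ∈ Q.confSet p β r, ∀ θ' ∈ Q.confSet p β r,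
      Q.meanFeature π ⬝ᵥ θ - Q.complexity q π * β ≤ Q.meanFeature π ⬝ᵥ θ' :=
    fun π θ h θ' h' => by
      have h1 := (meanFeature_dotProduct_le hp hq hpq hQ π (θ - θ')).trans
        (mul_le_mul_of_nonneg_left (hdiff θ h θ' h') (lpNormVec_nonneg hq _))
      rw [dotProduct_sub] at h1
      linarith
  have hpess : ∀ {π : S → A}, Admissible φ Q.rho π → Q.pessValue p β r π =
      sInf ((fun θ => Q.meanFeature π ⬝ᵥ θ) '' Q.confSet p β r) := fun {π} h => by
    rw [pessValue]
    simp_rw [Q.integral_dotProduct h]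
  have h1 : Q.pessValue p β r π ≤ Q.value π := by
    rw [hpess hπ.1, value, Q.integral_dotProduct hπ.1]
    refine csInf_le ⟨Q.meanFeature π ⬝ᵥ Q.theta - Q.complexity q π * β, ?_⟩ ⟨_, hθ, rfl⟩
    rintro _ ⟨θ, h, rfl⟩
    exact hvar π _ hθ θ h
  have h2 : Q.value π' - Q.complexity q π' * β ≤ Q.pessValue p β r π' := by
    rw [hpess hπ', value, Q.integral_dotProduct hπ']
    refine le_csInf ⟨_, ⟨_, hθ, rfl⟩⟩ ?_
    rintro _ ⟨θ, h, rfl⟩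
    exact hvar π' _ hθ θ h
  have h3 := hπ.2 π' hπ'
  linarith

lemma theta_mem_confSet {p : ℝ≥0∞} (hp : 1 ≤ p) {t β : ℝ} (ht : 0 ≤ t) {r : Fin n → ℝ}
    (h : ∀ j, |(matSqrt Q.sigma *ᵥ (Q.thetaOLS r - Q.theta)) j| ≤ t)
    (hβ : (d : ℝ) ^ (p⁻¹).toReal * t ≤ β / 2) : Q.theta ∈ Q.confSet p β r := by
  refine le_trans ?_ hβ
  rw [← neg_sub, Matrix.mulVec_neg, lpNormVec_neg hp]
  exact lpNormVec_le_of_forall_abs_le hp ht h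

/-- The bound for the `ℓ_p` rule against a comparator of bounded `ℓ_q` complexity, with the
constant `16`. -/
lemma rewardLaw_pessimistic_le (hd : 2 ≤ d) (hQ : IsUnit Q.sigma.det) {p q : ℝ≥0∞} (hp : 1 ≤ p)
    (hq : 1 ≤ q) (hpq : p⁻¹ + q⁻¹ = 1) {K : ℝ} {π' : S → A} (hπ' : Admissible φ Q.rho π')
    (hK : Q.complexity q π' ≤ K) {δ : ℝ} (hδ : 0 < δ) (hδ' : δ < 1) :
    Q.rewardLaw {r | ∃ π : S → A,
      Q.IsPessimistic p
        (16 * (d : ℝ) ^ (p⁻¹).toReal * Real.sqrt (Real.log (d / δ) / n)) r π ∧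
      16 * (d : ℝ) ^ (p⁻¹).toReal * Real.sqrt (Real.log (d / δ) / n) * K <
        Q.value π' - Q.value π} ≤ ENNReal.ofReal δ := by
  refine (measure_mono ?_).trans (rewardLaw_exists_coord_ge_le hd hQ hδ hδ')
  rintro r ⟨π, hπ, hlt⟩
  by_contra hr
  simp only [Set.mem_ofPred_eq, not_exists, not_le] at hr
  have hθ := theta_mem_confSet (β := 16 * (d : ℝ) ^ (p⁻¹).toReal *
    Real.sqrt (Real.log (d / δ) / n)) hp (by positivity) (fun j => (hr j).le) (by linarith)
  have h1 := hπ.value_sub_le hp hq hpq hQ hθ hπ'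
  have h2 := mul_le_mul_of_nonneg_right hK (by positivity :
    0 ≤ 16 * (d : ℝ) ^ (p⁻¹).toReal * Real.sqrt (Real.log (d / δ) / n))
  linarith

end Instance

end UpperBounds

/-! ### Two-point rewards -/

/-- The sign `±1` coded by a Boolean. -/
def boolSign (b : Bool) : ℝ := if b then 1 else -1

@[simp] lemma boolSign_true : boolSign true = 1 := rfl
@[simp] lemma boolSign_false : boolSign false = -1 := rfl

lemma boolSign_mul_self (b : Bool) : boolSign b * boolSign b = 1 := by cases b <;> simp

lemma boolSign_not (b : Bool) : boolSign (!b) = -boolSign b := by cases b <;> simp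

lemma abs_boolSign (b : Bool) : |boolSign b| = 1 := by cases b <;> simp

lemma one_add_mul_boolSign_nonneg {m : ℝ} (hm : |m| ≤ 1) (b : Bool) :
    0 ≤ 1 + m * boolSign b := by
  have := abs_le.1 hm
  cases b <;> simp <;> linarith

/-- The biased coin on the Booleans whose sign has mean `m`, for `|m| ≤ 1`. -/
def coin (m : ℝ) : Measure Bool :=
  ∑ b, ENNReal.ofReal ((1 + m * boolSign b) / 2) • Measure.dirac b

lemma coin_singleton (m : ℝ) (b : Bool) :
    coin m {b} = ENNReal.ofReal ((1 + m * boolSign b) / 2) := by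
  cases b <;> simp [coin]

lemma isProbabilityMeasure_coin {m : ℝ} (hm : |m| ≤ 1) : IsProbabilityMeasure (coin m) := by
  constructor
  have h1 := one_add_mul_boolSign_nonneg hm true
  have h2 := one_add_mul_boolSign_nonneg hm false
  simp only [boolSign_true, boolSign_false] at h1 h2
  simp only [coin, Fintype.sum_bool, Measure.coe_add, Measure.coe_smul, Pi.add_apply,
    Pi.smul_apply, measure_univ, smul_eq_mul, mul_one, boolSign_true, boolSign_false]
  rw [← ENNReal.ofReal_add (by linarith) (by linarith)]
  ring_nf
  simp

/-- The law on `{-1, 1}` with mean `m`, for `|m| ≤ 1`. -/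
def twoPoint (m : ℝ) : Measure ℝ := (coin m).map boolSign

lemma isProbabilityMeasure_twoPoint {m : ℝ} (hm : |m| ≤ 1) :
    IsProbabilityMeasure (twoPoint m) := by
  have := isProbabilityMeasure_coin hm
  exact Measure.isProbabilityMeasure_map (Measurable.of_discrete).aemeasurable

lemma ae_twoPoint_mem_Icc (m : ℝ) : ∀ᵐ x ∂twoPoint m, x ∈ Set.Icc (-1 : ℝ) 1 := by
  rw [twoPoint]
  refine (ae_map_iff (Measurable.of_discrete).aemeasurable measurableSet_Icc).2 ?_
  exact Filter.Eventually.of_forall fun b => by cases b <;> simp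

lemma integrable_twoPoint {m : ℝ} (hm : |m| ≤ 1) : Integrable (fun x : ℝ => x) (twoPoint m) := by
  have := isProbabilityMeasure_twoPoint hm
  exact Integrable.of_mem_Icc (-1) 1 aemeasurable_id' (ae_twoPoint_mem_Icc m)

lemma integral_twoPoint {m : ℝ} (hm : |m| ≤ 1) : ∫ x, x ∂twoPoint m = m := by
  have := isProbabilityMeasure_coin hm
  have h1 := one_add_mul_boolSign_nonneg hm true
  have h2 := one_add_mul_boolSign_nonneg hm false
  rw [twoPoint, integral_map (Measurable.of_discrete).aemeasurable (by fun_prop),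
    integral_fintype (Integrable.of_finite)]
  simp only [Measure.real, coin_singleton, Fintype.sum_bool, smul_eq_mul]
  rw [ENNReal.toReal_ofReal (by linarith), ENNReal.toReal_ofReal (by linarith)]
  simp
  ring

/-- Hoeffding's lemma makes the two-point laws `1`-subgaussian. -/
lemma isOneSubgaussian_twoPoint {m : ℝ} (hm : |m| ≤ 1) : IsOneSubgaussian (twoPoint m) := by
  have := isProbabilityMeasure_twoPoint hm
  intro t ht
  have hH := ProbabilityTheory.hasSubgaussianMGF_of_mem_Icc (X := fun x : ℝ => x)
    aemeasurable_id' (ae_twoPoint_mem_Icc m)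
  have h1 : ((‖(1 : ℝ) - (-1)‖₊ / 2) ^ 2 : NNReal) = 1 := by
    have : ‖(1 : ℝ) - (-1)‖₊ = 2 := by
      ext
      norm_num
    rw [this]
    norm_num
  rw [h1] at hH
  have key : ∀ {Y : ℝ → ℝ}, ProbabilityTheory.HasSubgaussianMGF Y 1 (twoPoint m) →
      twoPoint m {x | t ≤ Y x} ≤ ENNReal.ofReal (Real.exp (-t ^ 2 / 2)) := fun h => by
    have := h.measure_ge_le ht
    rw [Measure.real, NNReal.coe_one, mul_one] at this
    exact (ENNReal.le_ofReal_iff_toReal_le (measure_ne_top _ _) (Real.exp_pos _).le).2 this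
  calc _ ≤ twoPoint m ({x | t ≤ x - ∫ y, y ∂twoPoint m} ∪
        {x | t ≤ (-fun x => x - ∫ y, y ∂twoPoint m) x}) :=
        measure_mono fun x hx => le_abs.1 (show t ≤ |_| from hx)
    _ ≤ _ := (measure_union_le _ _).trans (add_le_add (key hH) (key hH.neg))
    _ = _ := by rw [← ENNReal.ofReal_add (Real.exp_pos _).le (Real.exp_pos _).le, two_mul]

/-- The probability of the sign vector coded by `b` under independent two-point laws. -/
def signWeight {n : ℕ} (m : Fin n → ℝ) (b : Fin n → Bool) : ℝ :=
  ∏ i, (1 + m i * boolSign (b i)) / 2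

lemma signWeight_nonneg {n : ℕ} {m : Fin n → ℝ} (hm : ∀ i, |m i| ≤ 1) (b : Fin n → Bool) :
    0 ≤ signWeight m b :=
  Finset.prod_nonneg fun i _ => div_nonneg (one_add_mul_boolSign_nonneg (hm i) _) zero_le_two

lemma sum_signWeight {n : ℕ} (m : Fin n → ℝ) : ∑ b, signWeight m b = 1 := by
  simp only [signWeight]
  rw [← Fintype.piFinset_univ,
    ← Finset.prod_univ_sum (fun _ => Finset.univ) fun i c => (1 + m i * boolSign c) / 2]
  refine Finset.prod_eq_one fun i _ => ?_
  simp
  ring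

/-- A product of two-point laws has finite support. -/
lemma lintegral_pi_twoPoint {n : ℕ} {m : Fin n → ℝ} (hm : ∀ i, |m i| ≤ 1)
    {f : (Fin n → ℝ) → ℝ≥0∞} (hf : Measurable f) :
    ∫⁻ r, f r ∂Measure.pi (fun i => twoPoint (m i)) =
      ∑ b : Fin n → Bool, f (fun i => boolSign (b i)) * ENNReal.ofReal (signWeight m b) := by
  have := fun i => isProbabilityMeasure_coin (hm i)
  have h := fun i => isProbabilityMeasure_twoPoint (hm i)
  have hs : Measurable boolSign := Measurable.of_discrete
  have e : Measure.pi (fun i => twoPoint (m i)) =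
      (Measure.pi fun i => coin (m i)).map fun b i => boolSign (b i) := by
    have : ∀ i, SigmaFinite ((coin (m i)).map boolSign) := fun i => by
      have := h i
      rw [twoPoint] at this
      infer_instance
    rw [Measure.pi_map_pi fun i => hs.aemeasurable]
    rfl
  rw [e, lintegral_map hf (Measurable.of_discrete), lintegral_fintype]
  refine Finset.sum_congr rfl fun b _ => ?_
  rw [Measure.pi_singleton, signWeight, ENNReal.ofReal_prod_of_nonneg fun i _ =>
    div_nonneg (one_add_mul_boolSign_nonneg (hm i) _) zero_le_two]
  simp_rw [coin_singleton]

/-! ### Indistinguishability of opposite signs -/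

/-- Two hypotheses which differ in the sign of the means `± e` of the rewards in `I` cannot be
told apart if `e ^ 2 |I| ≤ 1 / 2`. Their likelihood ratios `B`, `B'` with respect to fair coins
on `I` have the constant product `C = (1 - e ^ 2) ^ |I| ≥ 1 / 2`, and
`min B B' ≥ C (1 - (B + B') / 4)`, the tangent bound for `C / (B + B')`, is linear in `B + B'`. -/
lemma half_le_sum_signWeight {n : ℕ} (I : Finset (Fin n)) {m : Fin n → ℝ} (hm : ∀ i, |m i| ≤ 1)
    {e : ℝ} (he : |e| < 1) (hI : (I.card : ℝ) * e ^ 2 ≤ 1 / 2) {x y : (Fin n → Bool) → ℝ}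
    (hx : ∀ b, 0 ≤ x b) (hy : ∀ b, 0 ≤ y b) (hxy : ∀ b, x b + y b = 2) :
    1 / 2 ≤ ∑ b, (signWeight (fun i => if i ∈ I then e else m i) b * x b +
      signWeight (fun i => if i ∈ I then -e else m i) b * y b) := by
  set P : (Fin n → Bool) → ℝ := signWeight fun i => if i ∈ I then 0 else m i
  set B : ℝ → (Fin n → Bool) → ℝ := fun e b => ∏ i ∈ I, (1 + e * boolSign (b i)) with hB
  have hfac : ∀ e b, signWeight (fun i => if i ∈ I then e else m i) b = P b * B e b := fun e b => by
    simp only [P, hB, signWeight]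
    rw [← Finset.prod_ite_mem_eq I, ← Finset.prod_mul_distrib]
    refine Finset.prod_congr rfl fun i _ => ?_
    by_cases h : i ∈ I <;> simp [h]
    ring
  have hP : ∀ b, 0 ≤ P b := signWeight_nonneg fun i => by
    by_cases h : i ∈ I <;> simp [h, hm i]
  have hBpos : ∀ e : ℝ, |e| < 1 → ∀ b, 0 < B e b := fun e he b =>
    Finset.prod_pos fun i _ => by
      have := abs_lt.1 he
      cases b i <;> simp <;> linarith
  have he' : |(-e)| < 1 := by rwa [abs_neg]
  set C : ℝ := (1 - e ^ 2) ^ I.card with hC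
  have hBB : ∀ b, B e b * B (-e) b = C := fun b => by
    simp only [hB, hC]
    rw [← Finset.prod_mul_distrib, ← Finset.prod_const]
    refine Finset.prod_congr rfl fun i _ => ?_
    linear_combination -e ^ 2 * boolSign_mul_self (b i)
  have hChalf : 1 / 2 ≤ C := by
    have he2 : e ^ 2 ≤ 1 := by
      rw [← sq_abs]
      nlinarith [abs_nonneg e]
    have := one_add_mul_le_pow (a := -e ^ 2) (by linarith) I.card
    rw [← sub_eq_add_neg] at this
    linarith
  have hmin : ∀ u v : ℝ, 0 < u → u * v = C → C * (1 - (u + v) / 4) ≤ u := fun u v hu h => by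
    rw [← h]
    have h2 : u * v * (u + v) = u * (C + v ^ 2) := by rw [← h]; ring
    nlinarith [mul_nonneg hu.le (sq_nonneg (v / 2 - 1))]
  have hterm : ∀ b, 2 * (C * (P b - (P b * B e b + P b * B (-e) b) / 4)) ≤
      P b * B e b * x b + P b * B (-e) b * y b := fun b => by
    have h1 := hmin _ _ (hBpos e he b) (hBB b)
    have h2 := hmin _ _ (hBpos _ he' b) ((mul_comm _ _).trans (hBB b))
    rw [add_comm (B (-e) b)] at h2
    have h3 := mul_le_mul_of_nonneg_right h1 (hx b)
    have h4 := mul_le_mul_of_nonneg_right h2 (hy b)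
    have h5 := mul_le_mul_of_nonneg_left (add_le_add h3 h4) (hP b)
    rw [← mul_add, hxy] at h5
    linarith
  have hsum : ∀ e, ∑ b, P b * B e b = 1 := fun e => by
    simp_rw [← hfac]
    exact sum_signWeight _
  have hPsum : ∑ b, P b = 1 := sum_signWeight _
  simp_rw [hfac]
  refine le_trans ?_ (Finset.sum_le_sum fun b _ => hterm b)
  rw [← Finset.mul_sum, ← Finset.mul_sum, Finset.sum_sub_distrib, ← Finset.sum_div,
    Finset.sum_add_distrib, hsum, hsum, hPsum]
  linarith

/-! ### A family of instances indexed by sign vectors -/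

section SignInstances

variable {S : Type*} {d n : ℕ}

/-- The signs `1, -1, 0` of the three actions. -/
def actionSign : Fin 3 → ℝ := ![1, -1, 0]

lemma abs_actionSign_le (a : Fin 3) : |actionSign a| ≤ 1 := by
  fin_cases a <;> simp [actionSign]

/-- The feature mapping of the hard instances: in the state `s` the three actions have the features
`± sc s • e_{idx s}` and `0`. -/
def signFeature (idx : S → Fin d) (sc : S → ℝ) (s : S) (a : Fin 3) : Fin d → ℝ :=
  Pi.single (idx s) (sc s * actionSign a)

variable {idx : S → Fin d} {sc : S → ℝ}

lemma signFeature_dotProduct (s : S) (a : Fin 3) (θ : Fin d → ℝ) :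
    signFeature idx sc s a ⬝ᵥ θ = sc s * actionSign a * θ (idx s) := by
  simp [signFeature]

/-- The parameter with entries `± ε j`. -/
def signParam (ε : Fin d → ℝ) (σ : Fin d → Bool) (j : Fin d) : ℝ := ε j * boolSign (σ j)

lemma abs_signFeature_dotProduct_le (hsc : ∀ s, 0 ≤ sc s ∧ sc s ≤ 1) {ε : Fin d → ℝ}
    (hε : ∀ j, 0 ≤ ε j ∧ ε j < 1) (σ : Fin d → Bool) (s : S) (a : Fin 3) :
    |signFeature idx sc s a ⬝ᵥ signParam ε σ| ≤ 1 := by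
  rw [signFeature_dotProduct, abs_mul, abs_mul, signParam, abs_mul, abs_boolSign, mul_one,
    abs_of_nonneg (hsc s).1, abs_of_nonneg (hε _).1]
  exact mul_le_one₀ (mul_le_one₀ (hsc s).2 (abs_nonneg _) (abs_actionSign_le a)) (hε _).1
    (hε _).2.le

/-- The policy that follows the signs `σ`. -/
def signPolicy (idx : S → Fin d) (σ : Fin d → Bool) (s : S) : Fin 3 := if σ (idx s) then 0 else 1

lemma actionSign_signPolicy (σ : Fin d → Bool) (s : S) :
    actionSign (signPolicy idx σ s) = boolSign (σ (idx s)) := by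
  cases h : σ (idx s) <;> simp [signPolicy, h, actionSign]

lemma actionSign_mul_boolSign_le (a : Fin 3) (b : Bool) : actionSign a * boolSign b ≤ 1 := by
  refine (le_abs_self _).trans ?_
  rw [abs_mul, abs_boolSign, mul_one]
  exact abs_actionSign_le a

variable [MeasurableSpace S]

variable (idx) in
/-- The instance with two-point rewards and the parameter `± ε` with signs `σ`. -/
def signInstance (hsc : ∀ s, 0 ≤ sc s ∧ sc s ≤ 1) {ε : Fin d → ℝ}
    (hε : ∀ j, 0 ≤ ε j ∧ ε j < 1) (ρ : ProbabilityMeasure S) (cov : Fin n → S × Fin 3)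
    (σ : Fin d → Bool) : Instance (signFeature idx sc) n where
  rho := ρ
  cov := cov
  theta := signParam ε σ
  R s a := ⟨twoPoint (signFeature idx sc s a ⬝ᵥ signParam ε σ),
    isProbabilityMeasure_twoPoint (abs_signFeature_dotProduct_le hsc hε σ s a)⟩
  integrable_R s a := integrable_twoPoint (abs_signFeature_dotProduct_le hsc hε σ s a)
  mean_R s a := integral_twoPoint (abs_signFeature_dotProduct_le hsc hε σ s a)
  subgaussian_R s a := isOneSubgaussian_twoPoint (abs_signFeature_dotProduct_le hsc hε σ s a)

variable (hsc : ∀ s, 0 ≤ sc s ∧ sc s ≤ 1) {ε : Fin d → ℝ} (hε : ∀ j, 0 ≤ ε j ∧ ε j < 1)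
  (ρ : ProbabilityMeasure S) (cov : Fin n → S × Fin 3) (σ : Fin d → Bool)

/-! ### Complexity and regret in the sign instances -/

/-- Here `κ i` is the coordinate which the `i`-th sample observes, or `none` if its feature is `0`,
and `N j` counts the observations of the coordinate `j`. -/
lemma sigma_signInstance
    {κ : Fin n → Option (Fin d)} {N : Fin d → ℕ}
    (hκ : ∀ i, signFeature idx sc (cov i).1 (cov i).2 = (κ i).elim 0 fun j => Pi.single j 1)
    (hN : ∀ j, (Finset.univ.filter fun i => κ i = some j).card = N j) :
    (signInstance idx hsc hε ρ cov σ).sigma = Matrix.diagonal fun j => (N j : ℝ) / n := by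
  ext j k
  set v : Fin n → Fin d → ℝ := fun i => (κ i).elim 0 fun j => Pi.single j 1
  have h : ∀ i, v i j * v i k = if j = k ∧ κ i = some j then (1 : ℝ) else 0 := fun i => by
    simp only [v]
    cases κ i with
    | none => simp
    | some l => by_cases h1 : j = k <;> by_cases h2 : l = j <;> simp_all [Pi.single_apply, eq_comm]
  have e : (signInstance idx hsc hε ρ cov σ).sigma j k =
      (n : ℝ)⁻¹ * ∑ i, v i j * v i k := by
    simp_rw [show v = _ from funext fun i => (hκ i).symm]
    rfl
  rw [e]
  simp_rw [h]
  by_cases hjk : j = k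
  · subst hjk
    simp [← hN j, div_eq_inv_mul]
  · simp [hjk]

lemma isUnit_det_sigma_signInstance
    {κ : Fin n → Option (Fin d)} {N : Fin d → ℕ}
    (hκ : ∀ i, signFeature idx sc (cov i).1 (cov i).2 = (κ i).elim 0 fun j => Pi.single j 1)
    (hN : ∀ j, (Finset.univ.filter fun i => κ i = some j).card = N j) (hn : 0 < n)
    (hpos : ∀ j, 0 < N j) : IsUnit (signInstance idx hsc hε ρ cov σ).sigma.det := by
  rw [sigma_signInstance hsc hε ρ cov σ hκ hN, Matrix.det_diagonal]
  refine IsUnit.mk0 _ (Finset.prod_ne_zero_iff.2 fun j _ => ?_)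
  have h1 : (0 : ℝ) < N j := by exact_mod_cast hpos j
  have h2 : (0 : ℝ) < n := by exact_mod_cast hn
  positivity

lemma value_signInstance (π : S → Fin 3) :
    (signInstance idx hsc hε ρ cov σ).value π =
      ∫ s, sc s * ε (idx s) * (actionSign (π s) * boolSign (σ (idx s))) ∂(ρ : Measure S) := by
  refine integral_congr_ae (Filter.Eventually.of_forall fun s => ?_)
  change signFeature idx sc s (π s) ⬝ᵥ signParam ε σ = _
  rw [signFeature_dotProduct, signParam]
  ring

variable [Finite S] [MeasurableSingletonClass S]

lemma complexity_signInstance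
    {κ : Fin n → Option (Fin d)} {N : Fin d → ℕ}
    (hκ : ∀ i, signFeature idx sc (cov i).1 (cov i).2 = (κ i).elim 0 fun j => Pi.single j 1)
    (hN : ∀ j, (Finset.univ.filter fun i => κ i = some j).card = N j) (q : ℝ≥0∞)
    (π : S → Fin 3) :
    (signInstance idx hsc hε ρ cov σ).complexity q π =
      lpNormVec q fun j => (Real.sqrt (N j / n))⁻¹ *
        ∫ s, signFeature idx sc s (π s) j ∂(ρ : Measure S) := by
  rw [Instance.complexity, sigma_signInstance hsc hε ρ cov σ hκ hN, matInvSqrt_diagonal]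
  congr 1
  funext j
  rw [Matrix.mulVec_diagonal]
  congr 1
  exact eval_integral (fun _ => Integrable.of_finite) j

lemma isOptimal_signPolicy :
    (signInstance idx hsc hε ρ cov σ).IsOptimal (signPolicy idx σ) := by
  refine ⟨Integrable.of_finite, fun s a => ?_⟩
  change signFeature idx sc s a ⬝ᵥ signParam ε σ ≤
    signFeature idx sc s _ ⬝ᵥ signParam ε σ
  rw [signFeature_dotProduct, signFeature_dotProduct, signParam, actionSign_signPolicy]
  have h1 := mul_le_mul_of_nonneg_left (actionSign_mul_boolSign_le a (σ (idx s)))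
    (mul_nonneg (hsc s).1 (hε (idx s)).1)
  have h2 := congrArg (sc s * ε (idx s) * ·) (boolSign_mul_self (σ (idx s)))
  beta_reduce at h2
  linarith

/-- The regret in the instance with signs `σ` charges every state in which the policy deviates
from the sign. -/
lemma integral_le_optValue_sub (π : S → Fin 3) :
    ∫ s, sc s * ε (idx s) * (1 - actionSign (π s) * boolSign (σ (idx s))) ∂(ρ : Measure S) ≤
      (signInstance idx hsc hε ρ cov σ).optValue -
        (signInstance idx hsc hε ρ cov σ).value π := by
  have h1 : (signInstance idx hsc hε ρ cov σ).value (signPolicy idx σ) ≤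
      (signInstance idx hsc hε ρ cov σ).optValue :=
    le_csSup (Set.toFinite _).bddAbove ⟨_, Integrable.of_finite, rfl⟩
  refine le_trans (le_of_eq ?_) (sub_le_sub_right h1 _)
  rw [value_signInstance, value_signInstance,
    ← integral_sub Integrable.of_finite Integrable.of_finite]
  congr 1
  funext s
  rw [actionSign_signPolicy, boolSign_mul_self]
  ring

variable {cov} {κ : Fin n → Option (Fin d)}

/-- **Assouad's lemma** for the sign instances: if each coordinate `j` is observed at most
`1 / (2 ε_j ^ 2)` times, then some choice of the signs costs a quarter of the total range. -/
theorem exists_risk_ge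
    (hκ : ∀ i, signFeature idx sc (cov i).1 (cov i).2 = (κ i).elim 0 fun j => Pi.single j 1)
    (hN : ∀ j, ((Finset.univ.filter fun i => κ i = some j).card : ℝ) * ε j ^ 2 ≤ 1 / 2)
    (rule : LearningRule (signFeature idx sc) n) :
    ∃ σ, ENNReal.ofReal (1 / 4 * ∫ s, sc s * ε (idx s) ∂(ρ : Measure S)) ≤
      risk rule (signInstance idx hsc hε ρ cov σ) := by
  -- `m σ i` is the mean of the `i`-th reward; `a b` is the policy learned from the signs `b`
  set m : (Fin d → Bool) → Fin n → ℝ := fun σ i => (κ i).elim 0 (signParam ε σ) with hm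
  have hmean : ∀ σ i, signFeature idx sc (cov i).1 (cov i).2 ⬝ᵥ signParam ε σ = m σ i :=
    fun σ i => by
      rw [hκ i]
      simp only [hm]
      cases κ i <;> simp
  have hm1 : ∀ σ i, |m σ i| ≤ 1 := fun σ i => by
    rw [← hmean]
    exact abs_signFeature_dotProduct_le hsc hε σ _ _
  set a : (Fin n → Bool) → S → Fin 3 := fun b => rule.toFun ρ cov fun i => boolSign (b i)
  have hrisk : ∀ σ, ENNReal.ofReal (∑ b, signWeight (m σ) b *
      ∫ s, sc s * ε (idx s) * (1 - actionSign (a b s) * boolSign (σ (idx s))) ∂(ρ : Measure S)) ≤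
      risk rule (signInstance idx hsc hε ρ cov σ) := fun σ => by
    have hmeas : Measurable fun r => ENNReal.ofReal
        ((signInstance idx hsc hε ρ cov σ).optValue -
          (signInstance idx hsc hε ρ cov σ).value (rule.toFun ρ cov r)) :=
      (Measurable.of_discrete (f := fun π : S → Fin 3 => ENNReal.ofReal
        ((signInstance idx hsc hε ρ cov σ).optValue -
          (signInstance idx hsc hε ρ cov σ).value π))).comp (rule.measurable ρ cov)
    have hlaw : (signInstance idx hsc hε ρ cov σ).rewardLaw =
        Measure.pi fun i => twoPoint (m σ i) := by
      simp_rw [← hmean]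
      rfl
    change _ ≤ ∫⁻ r, ENNReal.ofReal
        ((signInstance idx hsc hε ρ cov σ).optValue -
          (signInstance idx hsc hε ρ cov σ).value (rule.toFun ρ cov r)) ∂_
    rw [hlaw, lintegral_pi_twoPoint (hm1 σ) hmeas, ENNReal.ofReal_sum_of_nonneg]
    · refine Finset.sum_le_sum fun b _ => ?_
      rw [ENNReal.ofReal_mul (signWeight_nonneg (hm1 σ) b), mul_comm]
      exact mul_le_mul' (ENNReal.ofReal_le_ofReal (integral_le_optValue_sub hsc hε ρ cov σ _)) le_rfl
    · refine fun b _ => mul_nonneg (signWeight_nonneg (hm1 σ) b) (integral_nonneg fun s => ?_)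
      exact mul_nonneg (mul_nonneg (hsc s).1 (hε _).1)
        (sub_nonneg.2 (actionSign_mul_boolSign_le _ _))
  -- averaging over the signs: pair each `σ` with the vector obtained by flipping coordinate `j`
  have hpair : ∀ s : S, (2 : ℝ) ^ d / 4 ≤
      ∑ σ, ∑ b, signWeight (m σ) b * (1 - actionSign (a b s) * boolSign (σ (idx s))) := fun s => by
    set j := idx s with hj
    set F : (Fin d → Bool) → ℝ := fun σ =>
      ∑ b, signWeight (m σ) b * (1 - actionSign (a b s) * boolSign (σ j)) with hF
    set flip : (Fin d → Bool) → (Fin d → Bool) := fun σ => Function.update σ j (!σ j) with hflip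
    have hinv : Function.Involutive flip := fun σ => by simp [hflip]
    have h2 : ∀ σ, 1 / 2 ≤ F σ + F (flip σ) := fun σ => by
      have h := half_le_sum_signWeight (Finset.univ.filter fun i => κ i = some j) (hm1 σ)
        (e := signParam ε σ j)
        (by rw [signParam, abs_mul, abs_boolSign, mul_one, abs_of_nonneg (hε j).1]; exact (hε j).2)
        (by rw [signParam, mul_pow, sq (boolSign _), boolSign_mul_self, mul_one]; exact hN j)
        (x := fun b => 1 - actionSign (a b s) * boolSign (σ j))
        (y := fun b => 1 - actionSign (a b s) * boolSign (!σ j))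
        (fun b => sub_nonneg.2 (actionSign_mul_boolSign_le _ _))
        (fun b => sub_nonneg.2 (actionSign_mul_boolSign_le _ _))
        (fun b => by rw [boolSign_not]; ring)
      rw [Finset.sum_add_distrib] at h
      have e1 : (fun i => if i ∈ Finset.univ.filter (fun i => κ i = some j) then signParam ε σ j
          else m σ i) = m σ := by
        funext i
        by_cases hi : κ i = some j <;> simp [hm, hi]
      have e2 : (fun i => if i ∈ Finset.univ.filter (fun i => κ i = some j) then -signParam ε σ j
          else m σ i) = m (flip σ) := by
        funext i
        by_cases hi : κ i = some j
        · simp [hm, hi, hflip, signParam, boolSign_not]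
        · simp only [Finset.mem_filter, Finset.mem_univ, true_and, hi, if_false, hm]
          cases hk : κ i with
          | none => rfl
          | some k =>
            have hkj : k ≠ j := fun h => hi (by rw [hk, h])
            simp [hflip, signParam, hkj]
      rw [e1, e2] at h
      refine h.trans (le_of_eq ?_)
      simp [hF, hflip]
    have h3 : ∑ σ, F (flip σ) = ∑ σ, F σ := Equiv.sum_comp hinv.toPerm F
    have h4 : ∑ _σ : Fin d → Bool, (1 / 2 : ℝ) ≤ ∑ σ, (F σ + F (flip σ)) :=
      Finset.sum_le_sum fun σ _ => h2 σ
    rw [Finset.sum_add_distrib, h3, Finset.sum_const, Finset.card_univ] at h4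
    simp only [Fintype.card_pi, Fintype.card_bool, Finset.prod_const, Finset.card_univ,
      Fintype.card_fin, nsmul_eq_mul, Nat.cast_pow, Nat.cast_ofNat] at h4
    linarith
  have hsum : ∑ _σ : Fin d → Bool, 1 / 4 * ∫ s, sc s * ε (idx s) ∂(ρ : Measure S) ≤
      ∑ σ, ∑ b, signWeight (m σ) b *
        ∫ s, sc s * ε (idx s) * (1 - actionSign (a b s) * boolSign (σ (idx s)))
          ∂(ρ : Measure S) := by
    have e : ∑ σ, ∑ b, signWeight (m σ) b *
        ∫ s, sc s * ε (idx s) * (1 - actionSign (a b s) * boolSign (σ (idx s))) ∂(ρ : Measure S) =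
        ∫ s, sc s * ε (idx s) * ∑ σ, ∑ b, signWeight (m σ) b *
          (1 - actionSign (a b s) * boolSign (σ (idx s))) ∂(ρ : Measure S) := by
      simp_rw [Finset.mul_sum]
      rw [integral_finsetSum _ fun _ _ => Integrable.of_finite]
      refine Finset.sum_congr rfl fun σ _ => ?_
      rw [integral_finsetSum _ fun _ _ => Integrable.of_finite]
      refine Finset.sum_congr rfl fun b _ => ?_
      rw [← integral_const_mul]
      congr 1
      funext s
      ring
    rw [e, Finset.sum_const, Finset.card_univ, nsmul_eq_mul, ← mul_assoc, ← integral_const_mul]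
    refine integral_mono Integrable.of_finite Integrable.of_finite fun s => ?_
    refine le_trans (le_of_eq ?_)
      (mul_le_mul_of_nonneg_left (hpair s) (mul_nonneg (hsc s).1 (hε (idx s)).1))
    simp
    ring
  obtain ⟨σ, -, hσ⟩ := Finset.exists_le_of_sum_le Finset.univ_nonempty hsum
  exact ⟨σ, (ENNReal.ofReal_le_ofReal hσ).trans (hrisk σ)⟩

lemma le_minimaxRisk
    (hκ : ∀ i, signFeature idx sc (cov i).1 (cov i).2 = (κ i).elim 0 fun j => Pi.single j 1)
    (hN : ∀ j, ((Finset.univ.filter fun i => κ i = some j).card : ℝ) * ε j ^ 2 ≤ 1 / 2)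
    {𝒞 : Set (Instance (signFeature idx sc) n)} (h𝒞 : ∀ σ, signInstance idx hsc hε ρ cov σ ∈ 𝒞) :
    ENNReal.ofReal (1 / 4 * ∫ s, sc s * ε (idx s) ∂(ρ : Measure S)) ≤ minimaxRisk 𝒞 := by
  refine le_iInf fun rule => ?_
  obtain ⟨σ, hσ⟩ := exists_risk_ge hsc hε ρ hκ hN rule
  exact hσ.trans (le_iSup₂_of_le (signInstance idx hsc hε ρ cov σ) (h𝒞 σ) le_rfl)

end SignInstances

/-- Covariates can be assigned to coordinates with prescribed multiplicities. -/
lemma exists_assignment {d n : ℕ} {N : Fin d → ℕ} (h : ∑ j, N j ≤ n) :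
    ∃ κ : Fin n → Option (Fin d), ∀ j, (Finset.univ.filter fun i => κ i = some j).card = N j := by
  have e : ((Σ j, Fin (N j)) ⊕ Fin (n - ∑ j, N j)) ≃ Fin n := by
    refine Fintype.equivFinOfCardEq ?_
    simp
    omega
  refine ⟨fun i => (e.symm i).elim (fun x => some x.1) fun _ => none, fun j => ?_⟩
  rw [Finset.card_filter, ← Equiv.sum_comp e]
  simp only [Equiv.symm_apply_apply, Fintype.sum_sum_type, Sum.elim_inl, Sum.elim_inr,
    Option.some.injEq, Fintype.sum_sigma]
  simp [apply_ite Finset.card]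

/-! ### The universal feature mapping -/

/-- The coordinate of a state: each of the first `d` states has its own, and the `d + 1` states
that follow share the coordinate `0`. -/
def hardIdx {d : ℕ} (hd : 0 < d) (s : Fin (2 * d + 1)) : Fin d :=
  if h : s.1 < d then ⟨s.1, h⟩ else ⟨0, hd⟩

/-- The scale of a state: `1` for the first `d` states, then `1, 1/2, 1/4, …, 2 ^ (-d)`. -/
def hardScale (d : ℕ) (s : Fin (2 * d + 1)) : ℝ :=
  if s.1 < d then 1 else (1 / 2) ^ (s.1 - d)

lemma hardScale_mem (d : ℕ) (s : Fin (2 * d + 1)) : 0 ≤ hardScale d s ∧ hardScale d s ≤ 1 := by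
  rw [hardScale]
  split_ifs
  · norm_num
  · exact ⟨by positivity, pow_le_one₀ (by norm_num) (by norm_num)⟩

/-- The state of unit scale with coordinate `j`. -/
def baseState {d : ℕ} (j : Fin d) : Fin (2 * d + 1) := ⟨j.1, by omega⟩

@[simp] lemma hardIdx_baseState {d : ℕ} (hd : 0 < d) (j : Fin d) :
    hardIdx hd (baseState j) = j := by
  simp [hardIdx, baseState]

@[simp] lemma hardScale_baseState {d : ℕ} (j : Fin d) : hardScale d (baseState j) = 1 := by
  simp [hardScale, baseState]

/-- The feature mapping of the lower bounds. -/
def hardFeature {d : ℕ} (hd : 0 < d) : Fin (2 * d + 1) → Fin 3 → Fin d → ℝ :=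
  signFeature (hardIdx hd) (hardScale d)

/-- The covariates which observe the coordinates assigned by `κ`; the others carry the feature
`0`. -/
def hardCov {d n : ℕ} (κ : Fin n → Option (Fin d)) (i : Fin n) : Fin (2 * d + 1) × Fin 3 :=
  (κ i).elim (0, 2) fun j => (baseState j, 0)

lemma hardFeature_hardCov {d n : ℕ} (hd : 0 < d) (κ : Fin n → Option (Fin d)) (i : Fin n) :
    signFeature (hardIdx hd) (hardScale d) (hardCov κ i).1 (hardCov κ i).2 =
      (κ i).elim 0 fun j => Pi.single j 1 := by
  rw [hardCov]
  cases κ i <;> simp [signFeature, actionSign]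

lemma one_div_sqrt_two_mul_mem {m : ℕ} (hm : 0 < m) :
    0 ≤ 1 / Real.sqrt (2 * m) ∧ 1 / Real.sqrt (2 * m) < 1 := by
  have hm' : (1 : ℝ) ≤ m := by exact_mod_cast hm
  refine ⟨by positivity, ?_⟩
  rw [div_lt_one (by positivity)]
  exact Real.lt_sqrt_of_sq_lt (by linarith)

lemma mul_one_div_sqrt_two_mul_sq {m : ℕ} (hm : 0 < m) :
    (m : ℝ) * (1 / Real.sqrt (2 * m)) ^ 2 ≤ 1 / 2 := by
  have hm' : (0 : ℝ) < m := by exact_mod_cast hm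
  rw [div_pow, Real.sq_sqrt (by positivity)]
  apply le_of_eq
  field_simp

/-- The uniform distribution on the states of unit scale. -/
def uniformBase {d : ℕ} (hd : 0 < d) : ProbabilityMeasure (Fin (2 * d + 1)) :=
  ⟨∑ j : Fin d, (d : ℝ≥0∞)⁻¹ • Measure.dirac (baseState j), ⟨by
    have h : (d : ℝ≥0∞) ≠ 0 := by exact_mod_cast hd.ne'
    simp [ENNReal.mul_inv_cancel h (ENNReal.natCast_ne_top d)]⟩⟩

lemma integral_uniformBase {d : ℕ} (hd : 0 < d) (f : Fin (2 * d + 1) → ℝ) :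
    ∫ s, f s ∂(uniformBase hd : Measure (Fin (2 * d + 1))) =
      (d : ℝ)⁻¹ * ∑ j, f (baseState j) := by
  have : (uniformBase hd : Measure (Fin (2 * d + 1))) =
    ∑ j : Fin d, (d : ℝ≥0∞)⁻¹ • Measure.dirac (baseState j) := rfl
  have h : (d : ℝ≥0∞) ≠ 0 := by exact_mod_cast hd.ne'
  rw [this, integral_finsetSum_measure fun j _ =>
    (integrable_dirac (by simp)).smul_measure (ENNReal.inv_ne_top.2 h), Finset.mul_sum]
  refine Finset.sum_congr rfl fun j _ => ?_
  rw [integral_smul_measure, integral_dirac]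
  simp

/-- All coordinates are tested equally often, and each is observed `m` times. -/
lemma le_minimaxRisk_of_uniform {d n m : ℕ} (hd : 0 < d) (hm : 0 < m) (hmn : d * m ≤ n)
    {q : ℝ≥0∞} (hq : 1 ≤ q) {Λ : ℝ}
    (hΛ : (d : ℝ) ^ (q⁻¹).toReal * ((Real.sqrt (m / n))⁻¹ * (d : ℝ)⁻¹) ≤ Λ) :
    ENNReal.ofReal (1 / 4 * (1 / Real.sqrt (2 * m))) ≤ minimaxRisk (CB (hardFeature hd) n q Λ) := by
  have hn : 0 < n := (Nat.mul_pos hd hm).trans_le hmn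
  obtain ⟨κ, hκ⟩ := exists_assignment (d := d) (n := n) (N := fun _ => m) (by simpa using hmn)
  have hε : ∀ _j : Fin d, 0 ≤ 1 / Real.sqrt (2 * m) ∧ 1 / Real.sqrt (2 * m) < 1 := fun _ =>
    one_div_sqrt_two_mul_mem hm
  have hmem : ∀ σ, signInstance (hardIdx hd) (hardScale_mem d) hε (uniformBase hd) (hardCov κ) σ ∈
      CB (hardFeature hd) n q Λ := fun σ => by
    refine ⟨isUnit_det_sigma_signInstance _ _ _ _ _ (hardFeature_hardCov hd κ) hκ hn fun _ => hm,
      ⟨_, isOptimal_signPolicy _ _ _ _ _⟩, fun π _ => le_trans ?_ hΛ⟩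
    have := complexity_signInstance (hardScale_mem d) hε (uniformBase hd) (hardCov κ) σ
      (hardFeature_hardCov hd κ) hκ q π
    refine this.trans_le (lpNormVec_le_of_forall_abs_le hq (by positivity) fun j => ?_)
    rw [abs_mul, abs_of_nonneg (by positivity : 0 ≤ (Real.sqrt (m / n))⁻¹), integral_uniformBase,
      abs_mul, abs_of_nonneg (by positivity : 0 ≤ (d : ℝ)⁻¹)]
    refine mul_le_mul_of_nonneg_left (mul_le_of_le_one_right (by positivity) ?_) (by positivity)
    rw [Finset.sum_eq_single j]
    · simpa [signFeature] using abs_actionSign_le _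
    · intro k _ hk
      simp [signFeature, hk.symm]
    · simp
  have h := le_minimaxRisk (hardScale_mem d) hε (uniformBase hd) (hardFeature_hardCov hd κ)
    (fun j => by rw [hκ]; exact mul_one_div_sqrt_two_mul_sq hm) hmem
  have hval : ∫ s, hardScale d s * (1 / Real.sqrt (2 * m))
      ∂(uniformBase hd : Measure (Fin (2 * d + 1))) = 1 / Real.sqrt (2 * m) := by
    have hd' : (d : ℝ) ≠ 0 := by exact_mod_cast hd.ne'
    rw [integral_uniformBase]
    simp [hd']
  rwa [hval] at h

/-- Only the coordinate `0` is tested, in a state `s₀`, and it is observed `N 0` times. -/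
lemma le_minimaxRisk_of_dirac {d n : ℕ} (hd : 0 < d) {N : Fin d → ℕ} (hm : 0 < N ⟨0, hd⟩)
    (hN : ∑ j, N j ≤ n) {s₀ : Fin (2 * d + 1)} (hs₀ : hardIdx hd s₀ = ⟨0, hd⟩) {Λ : ℝ}
    (hΛ : (Real.sqrt (N ⟨0, hd⟩ / n))⁻¹ * hardScale d s₀ ≤ Λ) :
    ((∀ j, 0 < N j) → ENNReal.ofReal (1 / 4 * (hardScale d s₀ * (1 / Real.sqrt (2 * N ⟨0, hd⟩)))) ≤
      minimaxRisk (CB (hardFeature hd) n 1 Λ)) ∧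
    ENNReal.ofReal (1 / 4 * (hardScale d s₀ * (1 / Real.sqrt (2 * N ⟨0, hd⟩)))) ≤
      minimaxRisk (CBPinv (hardFeature hd) n 1 Λ) := by
  set o : Fin d := ⟨0, hd⟩
  have hn : 0 < n := hm.trans_le ((Finset.single_le_sum (fun _ _ => Nat.zero_le _)
    (Finset.mem_univ o)).trans hN)
  obtain ⟨κ, hκ⟩ := exists_assignment hN
  set ε : Fin d → ℝ := fun j => if j = o then 1 / Real.sqrt (2 * N o) else 0 with hεdef
  have hε : ∀ j, 0 ≤ ε j ∧ ε j < 1 := fun j => by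
    by_cases h : j = o
    · simpa [hεdef, h] using one_div_sqrt_two_mul_mem hm
    · simp [hεdef, h]
  set ρ : ProbabilityMeasure (Fin (2 * d + 1)) := ⟨Measure.dirac s₀, inferInstance⟩
  have hint : ∀ f : Fin (2 * d + 1) → ℝ, ∫ s, f s ∂(ρ : Measure (Fin (2 * d + 1))) = f s₀ :=
    fun f => integral_dirac f s₀
  set Q := signInstance (hardIdx hd) (hardScale_mem d) hε ρ (hardCov κ) with hQ
  have hopt : ∀ σ, ∃ π, (Q σ).IsOptimal π := fun σ => ⟨_, isOptimal_signPolicy _ _ _ _ _⟩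
  -- the complexity bound holds for every policy, so ties between optimal policies do not matter
  have hcomp : ∀ σ π, (Q σ).complexity 1 π ≤ Λ := fun σ π => by
    have := complexity_signInstance (hardScale_mem d) hε ρ (hardCov κ) σ
      (hardFeature_hardCov hd κ) hκ 1 π
    refine (this.trans_le ?_).trans hΛ
    rw [lpNormVec_one, Finset.sum_eq_single o]
    · rw [hint, abs_mul, abs_of_nonneg (by positivity : 0 ≤ (Real.sqrt (N o / n))⁻¹)]
      refine mul_le_mul_of_nonneg_left ?_ (by positivity)
      simp only [signFeature, hs₀, Pi.single_eq_same]
      rw [abs_mul, abs_of_nonneg (hardScale_mem d s₀).1]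
      exact mul_le_of_le_one_right (hardScale_mem d s₀).1 (abs_actionSign_le _)
    · intro k _ hk
      rw [hint]
      simp [signFeature, hs₀, hk]
    · simp
  have hobs : ∀ j, ((Finset.univ.filter fun i => κ i = some j).card : ℝ) * ε j ^ 2 ≤ 1 / 2 :=
    fun j => by
      rw [hκ]
      by_cases h : j = o
      · simpa [hεdef, h] using mul_one_div_sqrt_two_mul_sq hm
      · simp [hεdef, h]
  have hval : ∫ s, hardScale d s * ε (hardIdx hd s) ∂(ρ : Measure (Fin (2 * d + 1))) =
      hardScale d s₀ * (1 / Real.sqrt (2 * N o)) := by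
    rw [hint, hs₀]
    simp [hεdef]
  rw [← hval]
  refine ⟨fun hpos => ?_, ?_⟩
  · refine le_minimaxRisk (hardScale_mem d) hε ρ (hardFeature_hardCov hd κ) hobs fun σ => ?_
    exact ⟨isUnit_det_sigma_signInstance _ _ _ _ _ (hardFeature_hardCov hd κ) hκ hn hpos, hopt σ,
      fun π _ => hcomp σ π⟩
  · refine le_minimaxRisk (hardScale_mem d) hε ρ (hardFeature_hardCov hd κ) hobs fun σ => ?_
    -- the mean feature is supported on the coordinate `0`, where `Σ` has the entry `N 0 / n`
    refine ⟨hopt σ, fun π _ => ⟨⟨Pi.single o (n / N o * (Q σ).meanFeature π o), ?_⟩, hcomp σ π⟩⟩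
    have hsig : (Q σ).sigma = _ := sigma_signInstance (hardScale_mem d) hε ρ (hardCov κ) σ
      (hardFeature_hardCov hd κ) hκ
    change (Q σ).sigma *ᵥ _ = (Q σ).meanFeature π
    rw [hsig]
    funext j
    rw [Matrix.mulVec_diagonal]
    have hm' : (N o : ℝ) ≠ 0 := by exact_mod_cast hm.ne'
    have hn' : (n : ℝ) ≠ 0 := by exact_mod_cast hn.ne'
    by_cases h : j = o
    · subst h
      rw [Pi.single_eq_same]
      field_simp
    · rw [Pi.single_eq_of_ne h, mul_zero]
      have e : (Q σ).meanFeature π j =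
          ∫ s, hardFeature hd s (π s) j ∂(ρ : Measure (Fin (2 * d + 1))) :=
        eval_integral (fun _ => Integrable.of_finite) j
      rw [e, hint]
      simp [hardFeature, signFeature, hs₀, h]

/-! ### The choice of the sample sizes -/

/-- `m = ⌈n / T ^ 2⌉` observations are enough for the complexity `T`, and rounding up costs at most
a factor `2`. -/
lemma exists_sample_size {T : ℝ} {n : ℕ} (hT : 0 < T) (hn : T ^ 2 ≤ n) :
    ∃ m : ℕ, 0 < m ∧ (m : ℝ) * T ^ 2 ≤ 2 * n ∧ (Real.sqrt (m / n))⁻¹ ≤ T ∧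
      1 / 16 * (Real.sqrt (1 / n) * T) ≤ 1 / 4 * (1 / Real.sqrt (2 * m)) := by
  have hT2 : 0 < T ^ 2 := by positivity
  have hn0 : (0 : ℝ) < n := hT2.trans_le hn
  have h1 : 1 ≤ (n : ℝ) / T ^ 2 := (one_le_div hT2).2 hn
  have hlow := Nat.le_ceil ((n : ℝ) / T ^ 2)
  have hup := Nat.ceil_lt_add_one (by positivity : 0 ≤ (n : ℝ) / T ^ 2)
  set m := ⌈(n : ℝ) / T ^ 2⌉₊
  have hm : (0 : ℝ) < m := by linarith
  have hmT : (m : ℝ) * T ^ 2 ≤ 2 * n := by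
    rw [← le_div_iff₀ hT2]
    calc (m : ℝ) ≤ n / T ^ 2 + n / T ^ 2 := by linarith
      _ = _ := by ring
  refine ⟨m, by exact_mod_cast hm, hmT, ?_, ?_⟩
  · rw [← Real.sqrt_inv, inv_div]
    refine Real.sqrt_le_iff.2 ⟨hT.le, ?_⟩
    rw [div_le_iff₀ hm, mul_comm]
    exact (div_le_iff₀ hT2).1 hlow
  · have h : Real.sqrt (1 / n) * T * Real.sqrt (2 * m) ≤ 2 := by
      rw [← Real.sqrt_sq hT.le, ← Real.sqrt_mul (by positivity), ← Real.sqrt_mul (by positivity)]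
      refine Real.sqrt_le_iff.2 ⟨by norm_num, ?_⟩
      have : 1 / (n : ℝ) * T ^ 2 * (2 * m) = 2 * (m * T ^ 2) / n := by ring
      rw [this, div_le_iff₀ hn0]
      linarith
    have hs : 0 < Real.sqrt (2 * m) := by positivity
    have h' := (le_div_iff₀ hs).2 h
    have e : 2 / Real.sqrt (2 * m) = 2 * (1 / Real.sqrt (2 * m)) := by ring
    rw [e] at h'
    linarith [one_div_pos.2 hs]

/-- The lower bound for general dual exponents. -/
lemma le_minimaxRisk_dual {d : ℕ} (hd : 0 < d) {p q : ℝ≥0∞} (hp : 1 ≤ p) (hq : 1 ≤ q)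
    (hpq : p⁻¹ + q⁻¹ = 1) {Λ : ℝ} {n : ℕ}
    (hΛ : Real.sqrt 8 * (d : ℝ) ^ ((q⁻¹).toReal - 1 / 2) ≤ Λ)
    (hn : (d : ℝ) ^ (2 * (p⁻¹).toReal) * Λ ^ 2 ≤ n) :
    ENNReal.ofReal (1 / 16 * (d : ℝ) ^ (p⁻¹).toReal * Real.sqrt (1 / n) * Λ) ≤
      minimaxRisk (CB (hardFeature hd) n q Λ) := by
  have hd' : (0 : ℝ) < d := by exact_mod_cast hd
  have hab : (p⁻¹).toReal + (q⁻¹).toReal = 1 := by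
    rw [← ENNReal.toReal_add (ENNReal.inv_ne_top.2 (by positivity))
      (ENNReal.inv_ne_top.2 (by positivity)), hpq, ENNReal.toReal_one]
  set a := (p⁻¹).toReal
  set b := (q⁻¹).toReal
  have hΛ0 : 0 < Λ := lt_of_lt_of_le (by positivity) hΛ
  have hT : 0 < (d : ℝ) ^ a * Λ := by positivity
  have hT2 : ((d : ℝ) ^ a * Λ) ^ 2 = (d : ℝ) ^ (2 * a) * Λ ^ 2 := by
    rw [mul_pow, mul_comm 2 a, Real.rpow_mul hd'.le, Real.rpow_two]
  obtain ⟨m, hm, hmT, h1, h2⟩ := exists_sample_size hT (hT2.trans_le hn)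
  -- `T = d ^ (1 / p) Λ` satisfies `T ^ 2 ≥ 8 d`, so that there is room for `m` samples in each of
  -- the `d` coordinates
  have h8 : 8 * (d : ℝ) ≤ ((d : ℝ) ^ a * Λ) ^ 2 := by
    have h3 : Real.sqrt 8 * (d : ℝ) ^ (1 / 2 : ℝ) ≤ (d : ℝ) ^ a * Λ := by
      calc Real.sqrt 8 * (d : ℝ) ^ (1 / 2 : ℝ)
          = (d : ℝ) ^ a * (Real.sqrt 8 * (d : ℝ) ^ (b - 1 / 2)) := by
            rw [mul_left_comm, ← Real.rpow_add hd']
            congr 2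
            linarith
        _ ≤ _ := mul_le_mul_of_nonneg_left hΛ (by positivity)
    have h4 := pow_le_pow_left₀ (by positivity) h3 2
    rwa [mul_pow, Real.sq_sqrt (by norm_num), ← Real.sqrt_eq_rpow, Real.sq_sqrt hd'.le] at h4
  have hdm : d * m ≤ n := by
    have : (m : ℝ) * (8 * d) ≤ 2 * n :=
      (mul_le_mul_of_nonneg_left h8 (by positivity)).trans hmT
    have h5 : (d : ℝ) * m ≤ n := by nlinarith [mul_nonneg hd'.le (Nat.cast_nonneg (α := ℝ) m)]
    exact_mod_cast h5
  refine le_trans (ENNReal.ofReal_le_ofReal ?_) (le_minimaxRisk_of_uniform hd hm hdm hq ?_)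
  · refine le_trans (le_of_eq ?_) h2
    ring
  · calc (d : ℝ) ^ b * ((Real.sqrt (m / n))⁻¹ * (d : ℝ)⁻¹)
        ≤ (d : ℝ) ^ b * ((d : ℝ) ^ a * Λ * (d : ℝ)⁻¹) := by gcongr
      _ = ((d : ℝ) ^ a * (d : ℝ) ^ b) * (d : ℝ)⁻¹ * Λ := by ring
      _ = Λ := by rw [← Real.rpow_add hd', hab, Real.rpow_one, mul_inv_cancel₀ hd'.ne', one_mul]

/-- The lower bound for `q = 1` without invertibility. -/
lemma le_minimaxRisk_CBPinv_one {d : ℕ} (hd : 0 < d) {Λ : ℝ} {n : ℕ} (hΛ : 2 ≤ Λ)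
    (hn : Λ ^ 2 ≤ n) :
    ENNReal.ofReal (1 / 16 * Real.sqrt (1 / n) * Λ) ≤
      minimaxRisk (CBPinv (hardFeature hd) n 1 Λ) := by
  obtain ⟨m, hm, hmT, h1, h2⟩ := exists_sample_size (by linarith) hn
  have hmn : m ≤ n := by
    have h4 := mul_le_mul_of_nonneg_left (by nlinarith : 4 ≤ Λ ^ 2) (Nat.cast_nonneg (α := ℝ) m)
    have : (m : ℝ) ≤ n := by linarith [Nat.cast_nonneg (α := ℝ) m]
    exact_mod_cast this
  have h := (le_minimaxRisk_of_dirac (n := n) hd (N := Pi.single ⟨0, hd⟩ m)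
    (by rwa [Pi.single_eq_same]) (by simpa using hmn)
    (hardIdx_baseState hd ⟨0, hd⟩) (Λ := Λ) (by simpa using h1)).2
  refine le_trans (ENNReal.ofReal_le_ofReal ?_) h
  rw [hardScale_baseState, one_mul, Pi.single_eq_same]
  linarith

/-- The lower bound for `q = 1` with invertibility. If `n ≥ 2 d`, one observation of each of the
coordinates which are not tested costs at most half of the sample. If `n < 2 d`, a single
observation of the tested coordinate remains, and testing in a state of smaller scale `τ`, with
`τ ≤ Λ / √n ≤ 2 τ`, compensates for the better coverage. -/
lemma le_minimaxRisk_CB_one {d : ℕ} (hd : 2 ≤ d) {Λ : ℝ} {n : ℕ} (hΛ : 2 ≤ Λ)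
    (hn : Λ ^ 2 ≤ n) (hdn : d ≤ n) :
    ENNReal.ofReal (1 / 16 * Real.sqrt (1 / n) * Λ) ≤
      minimaxRisk (CB (hardFeature (by omega : 0 < d)) n 1 Λ) := by
  have hd0 : 0 < d := by omega
  set o : Fin d := ⟨0, hd0⟩
  rcases le_or_gt (2 * d) n with h2d | h2d
  · obtain ⟨m, hm, hmT, h1, h2⟩ := exists_sample_size (by linarith) hn
    have hmn : 2 * m ≤ n := by
      have h4 := mul_le_mul_of_nonneg_left (by nlinarith : 4 ≤ Λ ^ 2) (Nat.cast_nonneg (α := ℝ) m)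
      have : 2 * (m : ℝ) ≤ n := by linarith
      exact_mod_cast this
    have hN : ∑ j, Function.update (fun _ : Fin d => 1) o m j ≤ n := by
      rw [Finset.sum_update_of_mem (Finset.mem_univ o)]
      have := Finset.card_le_univ (Finset.univ \ {o})
      simp only [Finset.sum_const, smul_eq_mul, mul_one, Fintype.card_fin] at this ⊢
      omega
    have h := (le_minimaxRisk_of_dirac (n := n) hd0 (N := Function.update (fun _ => 1) o m)
      (by rwa [Function.update_self]) hN
      (hardIdx_baseState hd0 o) (Λ := Λ)
      (by rw [Function.update_self, hardScale_baseState, mul_one]; exact h1)).1 (fun j => by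
        by_cases hj : j = o
        · rw [hj, Function.update_self]; exact hm
        · rw [Function.update_of_ne hj]; exact Nat.one_pos)
    refine le_trans (ENNReal.ofReal_le_ofReal ?_) h
    rw [hardScale_baseState, one_mul, Function.update_self]
    linarith
  · have hn0 : (0 : ℝ) < n := by exact_mod_cast (by omega : 0 < n)
    have hd' : (0 : ℝ) < d := by exact_mod_cast hd0
    set y := Real.sqrt (1 / n) * Λ with hy
    have hy2 : y ^ 2 = Λ ^ 2 / n := by
      rw [hy, mul_pow, Real.sq_sqrt (by positivity)]
      ring
    have hy0 : 0 < y := by positivity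
    have hy1 : y ≤ 1 := by
      have : y ^ 2 ≤ 1 := by rw [hy2, div_le_one hn0]; exact hn
      nlinarith
    obtain ⟨k, hk1, hk2⟩ := exists_nat_pow_near_of_lt_one hy0 hy1 (y := (1 / 2 : ℝ)) (by norm_num)
      (by norm_num)
    have hkd : k < d := by
      by_contra hle
      have h3 : (1 / 2 : ℝ) ^ k ≤ (1 / 2) ^ d :=
        pow_le_pow_of_le_one (by norm_num) (by norm_num) (not_lt.1 hle)
      have h4 : (1 / 2 : ℝ) ^ d * d ≤ 1 := by
        have : (d : ℝ) ≤ 2 ^ d := by exact_mod_cast d.lt_two_pow_self.le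
        rw [one_div, inv_pow, inv_mul_le_one₀ (by positivity)]
        exact this
      have h5 : y * d ≤ 1 :=
        (mul_le_mul_of_nonneg_right (hk2.trans h3) hd'.le).trans h4
      have h6 : y ^ 2 * n = Λ ^ 2 := by
        rw [hy2]
        field_simp
      have h7 : (n : ℝ) < 2 * d := by exact_mod_cast h2d
      nlinarith [mul_pos hy0 hy0, mul_le_mul_of_nonneg_left h5 hy0.le]
    set s₀ : Fin (2 * d + 1) := ⟨d + (k + 1), by omega⟩
    have hsc : hardScale d s₀ = (1 / 2) ^ (k + 1) := by simp [hardScale, s₀]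
    have hidx : hardIdx hd0 s₀ = o := by simp [hardIdx, s₀, o]
    have h := (le_minimaxRisk_of_dirac (n := n) hd0 (N := fun _ => 1) Nat.one_pos
      (by simpa using hdn) hidx (Λ := Λ) (by
        rw [hsc, Nat.cast_one, inv_mul_le_iff₀ (by positivity)]
        exact hk1.le)).1 fun _ => Nat.one_pos
    refine le_trans (ENNReal.ofReal_le_ofReal ?_) h
    rw [hsc, Nat.cast_one, mul_one]
    have hs : (1 : ℝ) / 2 ≤ 1 / Real.sqrt 2 := by
      refine one_div_le_one_div_of_le (by positivity) ?_
      exact Real.sqrt_le_iff.2 ⟨by norm_num, by norm_num⟩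
    have h3 : y ≤ 2 * (1 / 2) ^ (k + 1) := by
      rw [pow_succ]
      linarith
    have h4 := mul_le_mul_of_nonneg_left hs (by positivity : (0 : ℝ) ≤ (1 / 2) ^ (k + 1))
    linarith

end OfflineCB

end

theorem mainTheorem2 :
    -- the lower bounds
    (∃ c : ℝ, 0 < c ∧ ∀ d : ℕ, 2 ≤ d →
      ∃ (m k : ℕ) (φ : Fin (m + 1) → Fin (k + 1) → Fin d → ℝ),
        (∀ (p q : ℝ≥0∞), 1 ≤ p → 1 ≤ q → p⁻¹ + q⁻¹ = 1 → ∀ (Λ : ℝ) (n : ℕ),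
          Real.sqrt 8 * (d : ℝ) ^ ((q⁻¹).toReal - 1 / 2) ≤ Λ →
          (d : ℝ) ^ (2 * (p⁻¹).toReal) * Λ ^ 2 ≤ n →
          ENNReal.ofReal (c * (d : ℝ) ^ (p⁻¹).toReal * Real.sqrt (1 / n) * Λ) ≤
            OfflineCB.minimaxRisk (OfflineCB.CB φ n q Λ)) ∧
        -- the extended range for `p = ∞`, `q = 1`
        (∀ (Λ : ℝ) (n : ℕ), 2 ≤ Λ → Λ ^ 2 ≤ n →
          (d ≤ n → ENNReal.ofReal (c * Real.sqrt (1 / n) * Λ) ≤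
            OfflineCB.minimaxRisk (OfflineCB.CB φ n 1 Λ)) ∧
          ENNReal.ofReal (c * Real.sqrt (1 / n) * Λ) ≤
            OfflineCB.minimaxRisk (OfflineCB.CBPinv φ n 1 Λ))) ∧
    -- the matching upper bounds
    (∃ C : ℝ, 0 < C ∧ ∀ d : ℕ, 2 ≤ d →
      ∀ (S A : Type*) [MeasurableSpace S] (φ : S → A → Fin d → ℝ) (n : ℕ)
        (Q : OfflineCB.Instance φ n), IsUnit Q.sigma.det →
        ∀ (p q : ℝ≥0∞), 1 ≤ p → 1 ≤ q → p⁻¹ + q⁻¹ = 1 →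
        ∀ (Λ : ℝ) (πstar : S → A), Q.IsOptimal πstar → Q.complexity q πstar ≤ Λ →
        ∀ δ : ℝ, 0 < δ → δ < 1 →
          -- the rule for `p` over the class for the dual exponent `q`
          Q.rewardLaw {r | ∃ π : S → A,
              Q.IsPessimistic p
                (C * (d : ℝ) ^ (p⁻¹).toReal * Real.sqrt (Real.log (d / δ) / n)) r π ∧
              C * (d : ℝ) ^ (p⁻¹).toReal * Real.sqrt (Real.log (d / δ) / n) * Λ <
                Q.value πstar - Q.value π} ≤ ENNReal.ofReal δ ∧
          -- the rule for `∞` over the same class, with a width that does not depend on `q`, `Λ`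
          Q.rewardLaw {r | ∃ π : S → A,
              Q.IsPessimistic ∞ (C * Real.sqrt (Real.log (d / δ) / n)) r π ∧
              C * (d : ℝ) ^ (p⁻¹).toReal * Real.sqrt (Real.log (d / δ) / n) * Λ <
                Q.value πstar - Q.value π} ≤ ENNReal.ofReal δ) := by
  refine ⟨⟨1 / 16, by norm_num, fun d hd => ⟨2 * d, 2, OfflineCB.hardFeature (by omega), ?_, ?_⟩⟩,
    16, by norm_num, ?_⟩
  · intro p q hp hq hpq Λ n hΛ hn
    exact OfflineCB.le_minimaxRisk_dual _ hp hq hpq hΛ hn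
  · intro Λ n hΛ hn
    exact ⟨fun hdn => OfflineCB.le_minimaxRisk_CB_one hd hΛ hn hdn,
      OfflineCB.le_minimaxRisk_CBPinv_one _ hΛ hn⟩
  · intro d hd S A _ φ n Q hQ p q hp hq hpq Λ π' hopt hΛ δ hδ hδ'
    refine ⟨OfflineCB.Instance.rewardLaw_pessimistic_le hd hQ hp hq hpq hopt.1 hΛ hδ hδ', ?_⟩
    -- the `ℓ_∞` rule sees the `ℓ_1` complexity, at most `d ^ (1 / p)` times the `ℓ_q` complexity
    have h1 : Q.complexity 1 π' ≤ (d : ℝ) ^ (p⁻¹).toReal * Λ :=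
      (OfflineCB.lpNormVec_one_le hp hq hpq _).trans
        (mul_le_mul_of_nonneg_left hΛ (by positivity))
    have h := OfflineCB.Instance.rewardLaw_pessimistic_le hd hQ (p := ∞) (q := 1) le_top le_rfl
      (by simp) hopt.1 h1 hδ hδ'
    simp only [ENNReal.inv_top, ENNReal.toReal_zero, Real.rpow_zero, mul_one] at h
    have e : 16 * (d : ℝ) ^ (p⁻¹).toReal * Real.sqrt (Real.log (d / δ) / n) * Λ =
        16 * Real.sqrt (Real.log (d / δ) / n) * ((d : ℝ) ^ (p⁻¹).toReal * Λ) := by ring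
    rw [e]
    exact h
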